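/- Let $\mathbb{K}$ be a field of characteristic zero. Conventions. A Young tableau of shape $\lambda$ with set of entries $A$ is a bijection $T:D_\lambda\to A$ from the boxes $D_\lambda=\{(i,j):1\le j\le\lambda_i\}$ of the Young diagram of $\lambda$ ($i$ is the row, $j$ the column). Its Young symmetrizer is $\mathfrak{c}_\lambda(T)=\big(\sum_{\sigma\in\mathcal{R}_T}\sigma\big)\cdot\big(\sum_{\tau\in\mathcal{C}_T}\mathrm{sgn}(\tau)\,\tau\big)\in\mathbb{K}[\mathfrak{S}_A]$, where $\mathcal{R}_T$ (resp. $\mathcal{C}_T$) is the group of permutations of $A$ that preserve each row (resp. each column) of $T$. For partitions $\mu\subset\lambda$ (i.e. $\mu_i\le\lambda_i$ for all $i$), the subtableau of $T$ of shape $\mu$ is the restriction $T|_{D_\mu}$. The generic tensor algebra is the vector space $\mathscr{T}=\bigoplus_{n\ge 0}\mathbb{K}[\mathfrak{S}_n]$ with the bilinear multiplication given for $\sigma\in\mathfrak{S}_n$, $\tau\in\mathfrak{S}_m$ by $\sigma*\tau\in\mathfrak{S}_{n+m}$, $(\sigma*\tau)(i)=\sigma(i)$ for $i\le n$ and $(\sigma*\tau)(i)=n+\tau(i-n)$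 for $n+1\le i\le n+m$. A homogeneous invariant right ideal is a homogeneous right ideal $\mathscr{I}=\bigoplus_n\mathscr{I}_n$ of $\mathscr{T}$ such that each $\mathscr{I}_n$ is a left ideal of the group algebra $\mathbb{K}[\mathfrak{S}_n]$; $\mathscr{I}(E)$ denotes the smallest one containing $E\subset\mathscr{T}$. For Young tableaux $S,S'$ with set of entries $[k]=\{1,\dots,k\}$, $S'$ dominates $S$ if for every $i\in[k]$ the index of the column of $S'$ containing $i$ is at most the index of the column of $S$ containing $i$. Theorem. Let $k\le n$ be positive integers, let $\lambda\vdash n$ and $\mu\vdash k$ be partitions with $\mu\subset\lambda$, and let $T$ be a Young tableau of shape $\lambda$ with set of entries $[n]$ whose subtableau $S$ of shape $\mu$ has set of entries $[k]$. Let $\mathcal{S}$ be the set of all Young tableaux $S'$ with set of entries $[k]$, of some shape $\delta\vdash k$ with $\delta\subset\lambda$, that dominate $S$. Then $$\mathfrak{c}_\lambda(T)\in\mathscr{I}\big(\mathfrak{c}_\delta(S') : S'\in\mathcal{S}\big).$$ -/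

import Mathlib

namespace GenericTensor

/-- A Young tableau of shape `μ` and set of entries `A`: a bijection from the boxes of `μ` to `A`.
A box `(i, j)` lies in row `i` and column `j` (both counted from `0`). -/
abbrev YoungTableau (μ : YoungDiagram) (A : Type*) := {c : ℕ × ℕ // c ∈ μ} ≃ A

section Symmetrizer

variable {μ : YoungDiagram} {A : Type*}

/-- The index of the row of `T` containing the entry `a`. -/
def rowOf (T : YoungTableau μ A) (a : A) : ℕ := (T.symm a).1.1

/-- The index of the column of `T` containing the entry `a`. -/
def colOf (T : YoungTableau μ A) (a : A) : ℕ := (T.symm a).1.2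

/-- The permutations of `A` that preserve every fibre of `f`; this is the product of the
symmetric groups of the fibres. -/
def fibreSubgroup (f : A → ℕ) : Subgroup (Equiv.Perm A) where
  carrier := {σ | ∀ a, f (σ a) = f a}
  mul_mem' := by
    intro σ τ hσ hτ a
    rw [Equiv.Perm.mul_apply, hσ, hτ]
  one_mem' := fun _ => rfl
  inv_mem' := by
    intro σ hσ a
    have h := hσ (σ⁻¹ a)
    rw [← Equiv.Perm.mul_apply, mul_inv_cancel, Equiv.Perm.one_apply] at h
    exact h.symm

/-- The row subgroup of a tableau. -/
def rowSubgroup (T : YoungTableau μ A) : Subgroup (Equiv.Perm A) := fibreSubgroup (rowOf T)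

/-- The column subgroup of a tableau. -/
def colSubgroup (T : YoungTableau μ A) : Subgroup (Equiv.Perm A) := fibreSubgroup (colOf T)

variable (K : Type*) [Field K] [Fintype A] [DecidableEq A]

open Classical in
/-- The sum of all elements of the row subgroup. -/
noncomputable def rowSymmetrizer (T : YoungTableau μ A) : MonoidAlgebra K (Equiv.Perm A) :=
  ∑ σ : Equiv.Perm A with σ ∈ rowSubgroup T, MonoidAlgebra.single σ 1

open Classical in
/-- The signed sum of all elements of the column subgroup. -/
noncomputable def colAntisymmetrizer (T : YoungTableau μ A) : MonoidAlgebra K (Equiv.Perm A) :=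
  ∑ τ : Equiv.Perm A with τ ∈ colSubgroup T,
    MonoidAlgebra.single τ (((Equiv.Perm.sign τ : ℤˣ) : ℤ) : K)

/-- The Young symmetrizer of a tableau, an element of the group algebra `K[S_A]`. -/
noncomputable def youngSymmetrizer (T : YoungTableau μ A) : MonoidAlgebra K (Equiv.Perm A) :=
  rowSymmetrizer K T * colAntisymmetrizer K T

end Symmetrizer

/-- `S`, with entries `[k]`, is the Young subtableau of shape `μ` of the tableau `T` with
entries `[n]`: it is the restriction of `T` to the boxes of `μ`. -/
def IsSubtableau {mu lam : YoungDiagram} (h : mu ≤ lam) {k n : ℕ} (hkn : k ≤ n)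
    (S : YoungTableau mu (Fin k)) (T : YoungTableau lam (Fin n)) : Prop :=
  ∀ c : {c : ℕ × ℕ // c ∈ mu}, T ⟨c.1, h c.2⟩ = Fin.castLE hkn (S c)

/-- `S'` dominates `S`: every entry lies in `S'` weakly to the left of its column in `S`. -/
def Dominates {delta mu : YoungDiagram} {k : ℕ}
    (S' : YoungTableau delta (Fin k)) (S : YoungTableau mu (Fin k)) : Prop :=
  ∀ i : Fin k, colOf S' i ≤ colOf S i

/-- Concatenation of permutations: `σ` acts on the first `n` letters and `τ` on the
last `m` letters. -/
def concatPerm {n m : ℕ} (σ : Equiv.Perm (Fin n)) (τ : Equiv.Perm (Fin m)) :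
    Equiv.Perm (Fin (n + m)) :=
  finSumFinEquiv.permCongr (Equiv.sumCongr σ τ)

theorem concatPerm_castAdd {n m : ℕ} (σ : Equiv.Perm (Fin n)) (τ : Equiv.Perm (Fin m))
    (i : Fin n) : concatPerm σ τ (Fin.castAdd m i) = Fin.castAdd m (σ i) := by
  simp [concatPerm, Equiv.permCongr_apply]

theorem concatPerm_natAdd {n m : ℕ} (σ : Equiv.Perm (Fin n)) (τ : Equiv.Perm (Fin m))
    (j : Fin m) : concatPerm σ τ (Fin.natAdd n j) = Fin.natAdd n (τ j) := by
  simp [concatPerm, Equiv.permCongr_apply]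

section Algebra

variable (K : Type*) [Field K]

/-- The degree `n` component `K[S_n]` of the generic tensor algebra. -/
abbrev Component (n : ℕ) := MonoidAlgebra K (Equiv.Perm (Fin n))

/-- The underlying `K`-vector space `⨁ n, K[S_n]` of the generic tensor algebra. -/
abbrev GenericTensorAlgebra := DirectSum ℕ (Component K)

/-- The inclusion of the degree `n` component. -/
noncomputable abbrev incl (n : ℕ) : Component K n →ₗ[K] GenericTensorAlgebra K :=
  DirectSum.lof K ℕ (Component K) n

/-- The bilinear extension of the concatenation of permutations. -/
noncomputable def concat (n m : ℕ) :
    Component K n →ₗ[K] Component K m →ₗ[K] Component K (n + m) :=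
  LinearMap.mk₂ K
    (fun x y => ∑ σ : Equiv.Perm (Fin n), ∑ τ : Equiv.Perm (Fin m),
      MonoidAlgebra.single (concatPerm σ τ) (x.coeff σ * y.coeff τ))
    (by intro x x' y; simp [add_mul, Finset.sum_add_distrib])
    (by intro c x y; simp [Finset.smul_sum, mul_assoc])
    (by intro x y y'; simp [mul_add, Finset.sum_add_distrib])
    (by intro c x y; simp [Finset.smul_sum, mul_left_comm])

/-- The multiplication of the generic tensor algebra. -/
noncomputable def genMul :
    GenericTensorAlgebra K →ₗ[K] GenericTensorAlgebra K →ₗ[K] GenericTensorAlgebra K :=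
  DirectSum.toModule K ℕ _ fun n =>
    LinearMap.flip <| DirectSum.toModule K ℕ _ fun m =>
      LinearMap.flip <| (concat K n m).compr₂ (incl K (n + m))

theorem genMul_single {n m : ℕ} (σ : Equiv.Perm (Fin n)) (τ : Equiv.Perm (Fin m)) :
    genMul K (incl K n (MonoidAlgebra.single σ 1)) (incl K m (MonoidAlgebra.single τ 1)) =
      incl K (n + m) (MonoidAlgebra.single (concatPerm σ τ) 1) := by
  have h : concat K n m (MonoidAlgebra.single σ 1) (MonoidAlgebra.single τ 1) =
      MonoidAlgebra.single (concatPerm σ τ) 1 := by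
    rw [concat, LinearMap.mk₂_apply, Finset.sum_eq_single σ, Finset.sum_eq_single τ]
    · simp
    · intro x _ hx
      simp [Finsupp.single_apply, hx.symm]
    · simp
    · intro x _ hx
      simp [Finsupp.single_apply, hx.symm]
    · simp
  simp [genMul, h]

variable {K}

/-- Homogeneous invariant right ideals of the generic tensor algebra. -/
structure IsHomogeneousInvariantRightIdeal
    (I : Submodule K (GenericTensorAlgebra K)) : Prop where
  /-- `I` is a right ideal. -/
  mul_mem : ∀ x ∈ I, ∀ y : GenericTensorAlgebra K, genMul K x y ∈ I
  /-- `I` is homogeneous. -/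
  component_mem : ∀ x ∈ I, ∀ n : ℕ, incl K n (x n) ∈ I
  /-- Each homogeneous component of `I` is a left ideal of the group algebra `K[S_n]`. -/
  left_mul_mem : ∀ (n : ℕ) (a x : Component K n), incl K n x ∈ I → incl K n (a * x) ∈ I

/-- The smallest homogeneous invariant right ideal containing `E`. -/
noncomputable def idealGenerated (E : Set (GenericTensorAlgebra K)) : Submodule K (GenericTensorAlgebra K) :=
  sInf {I | IsHomogeneousInvariantRightIdeal I ∧ E ⊆ I}

theorem isHomogeneousInvariantRightIdeal_idealGenerated (E : Set (GenericTensorAlgebra K)) :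
    IsHomogeneousInvariantRightIdeal (idealGenerated E) where
  mul_mem x hx y := by
    rw [idealGenerated, Submodule.mem_sInf] at hx ⊢
    exact fun I hI => hI.1.mul_mem x (hx I hI) y
  component_mem x hx n := by
    rw [idealGenerated, Submodule.mem_sInf] at hx ⊢
    exact fun I hI => hI.1.component_mem x (hx I hI) n
  left_mul_mem n a x hx := by
    rw [idealGenerated, Submodule.mem_sInf] at hx ⊢
    exact fun I hI => hI.1.left_mul_mem n a x (hx I hI)

theorem subset_idealGenerated (E : Set (GenericTensorAlgebra K)) :
    E ⊆ idealGenerated E := by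
  intro x hx
  rw [SetLike.mem_coe, idealGenerated, Submodule.mem_sInf]
  exact fun I hI => hI.2 hx

end Algebra

end GenericTensor

/-! Write c(T) for the Young symmetrizer, n = k + m, call the letters of [k] small, and let A_S be
the signed sum over the column group of S, all inside K[S_n]. In degree n the ideal is a left ideal
containing the embedded c(S') for every S' dominating S, and right multiplication only relabels:
c(T)σ = σ c(σ⁻¹T). The proof is an induction on the sum of the columns of T occupied by small
letters (`firstColSum`).

Let L be the left ideal generated by the c(T') of smaller column sum. First, c(T)c(S) is a nonzero
multiple of c(T) modulo L (`exists_youngSymmetrizer_mul_embedAlg_sub_smul_mem`). Indeed a Garnir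
relation of S, completed by the large entries of T in its left column, is a Garnir relation of T;
its extra terms push large letters right, hence small letters left, and so lie in L. Straightening
c(S) with such relations leaves a multiple of A_S, which is nonzero because c(S)² ≠ 0.

Secondly, the tableaux T' in L need not restrict to tableaux dominating S, but right multiplication
by A_S repairs this (`youngSymmetrizer_mul_antisymmetrizer_mem_span`). Label the small letters by
their columns in S and the others by distinct larger labels. Straightening makes labels increase
strictly along rows; so each small letter is weakly left of its column in S and, up to a column
permutation, the small letters fill a subdiagram. Thus L·A_S lies in the ideal by induction. Since
c(T)A_S is a nonzero multiple of c(T), and c(T)c(S)A_S a multiple of c(T)c(S), the theorem follows.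
-/

namespace GenericTensor

open Equiv.Perm

/-! ### Signed sums over subgroups -/

section Antisymmetrizer

variable {A : Type*} [Fintype A] [DecidableEq A] (K : Type*) [Field K]

/-- The sign of a permutation as an element of `K`. -/
def signIn (σ : Equiv.Perm A) : K := ((sign σ : ℤˣ) : ℤ)

theorem signIn_mul (σ τ : Equiv.Perm A) : signIn K (σ * τ) = signIn K σ * signIn K τ := by
  simp [signIn]

theorem signIn_one : signIn K (1 : Equiv.Perm A) = 1 := by simp [signIn]

theorem signIn_mul_self (σ : Equiv.Perm A) : signIn K σ * signIn K σ = 1 := by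
  rw [signIn, ← Int.cast_mul, ← Units.val_mul, Int.units_mul_self]
  simp

theorem signIn_inv (σ : Equiv.Perm A) : signIn K σ⁻¹ = signIn K σ := by simp [signIn]

open Classical in
/-- The signed sum of the elements of a subgroup. -/
noncomputable def antisymmetrizer (H : Subgroup (Equiv.Perm A)) :
    MonoidAlgebra K (Equiv.Perm A) :=
  ∑ τ : Equiv.Perm A with τ ∈ H, MonoidAlgebra.single τ (signIn K τ)

variable {K}

theorem single_mul_antisymmetrizer {H : Subgroup (Equiv.Perm A)} {σ : Equiv.Perm A} (hσ : σ ∈ H) :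
    MonoidAlgebra.single σ 1 * antisymmetrizer K H = signIn K σ • antisymmetrizer K H := by
  classical
  rw [antisymmetrizer, Finset.mul_sum, Finset.smul_sum]
  refine Finset.sum_bij' (fun τ _ => σ * τ) (fun τ _ => σ⁻¹ * τ) ?_ ?_ ?_ ?_ ?_
  · intro τ hτ
    simpa [Subgroup.mul_mem_cancel_left H hσ] using hτ
  · intro τ hτ
    simpa [Subgroup.mul_mem_cancel_left H (H.inv_mem hσ)] using hτ
  · simp
  · simp
  · intro τ _
    rw [MonoidAlgebra.single_mul_single, MonoidAlgebra.smul_single, signIn_mul, smul_eq_mul,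
      ← mul_assoc, signIn_mul_self]

theorem antisymmetrizer_mul_single {H : Subgroup (Equiv.Perm A)} {σ : Equiv.Perm A} (hσ : σ ∈ H) :
    antisymmetrizer K H * MonoidAlgebra.single σ 1 = signIn K σ • antisymmetrizer K H := by
  classical
  rw [antisymmetrizer, Finset.sum_mul, Finset.smul_sum]
  refine Finset.sum_bij' (fun τ _ => τ * σ) (fun τ _ => τ * σ⁻¹) ?_ ?_ ?_ ?_ ?_
  · intro τ hτ
    simpa [Subgroup.mul_mem_cancel_right H hσ] using hτ
  · intro τ hτ
    simpa [Subgroup.mul_mem_cancel_right H (H.inv_mem hσ)] using hτ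
  · simp
  · simp
  · intro τ _
    rw [MonoidAlgebra.single_mul_single, MonoidAlgebra.smul_single, signIn_mul, smul_eq_mul,
      mul_left_comm, signIn_mul_self, mul_one]

theorem mul_antisymmetrizer (x : MonoidAlgebra K (Equiv.Perm A)) (H : Subgroup (Equiv.Perm A))
    [DecidablePred (· ∈ H)] :
    x * antisymmetrizer K H =
      ∑ τ : Equiv.Perm A with τ ∈ H, signIn K τ • (x * MonoidAlgebra.single τ 1) := by
  rw [antisymmetrizer, Finset.mul_sum]
  refine Finset.sum_congr (by congr) fun τ _ => ?_
  rw [← mul_smul_comm, MonoidAlgebra.smul_single, smul_eq_mul, mul_one]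

theorem antisymmetrizer_mul (x : MonoidAlgebra K (Equiv.Perm A)) (H : Subgroup (Equiv.Perm A))
    [DecidablePred (· ∈ H)] :
    antisymmetrizer K H * x =
      ∑ τ : Equiv.Perm A with τ ∈ H, signIn K τ • (MonoidAlgebra.single τ 1 * x) := by
  rw [antisymmetrizer, Finset.sum_mul]
  refine Finset.sum_congr (by congr) fun τ _ => ?_
  rw [← smul_mul_assoc, MonoidAlgebra.smul_single, smul_eq_mul, mul_one]

/-- An element on which a subgroup acts by the sign is reproduced, up to a nonzero scalar, by the
antisymmetrizer of the subgroup. -/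
theorem exists_mul_antisymmetrizer_eq_smul [CharZero K] {x : MonoidAlgebra K (Equiv.Perm A)}
    {H : Subgroup (Equiv.Perm A)}
    (hx : ∀ τ ∈ H, x * MonoidAlgebra.single τ 1 = signIn K τ • x) :
    ∃ c : K, c ≠ 0 ∧ x * antisymmetrizer K H = c • x := by
  classical
  refine ⟨((Finset.univ.filter (· ∈ H)).card : K), ?_, ?_⟩
  · rw [Nat.cast_ne_zero]
    exact Finset.card_ne_zero_of_mem (a := 1) (by simp [H.one_mem])
  · rw [mul_antisymmetrizer, Finset.sum_congr rfl (g := fun _ => x), Finset.sum_const,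
      Nat.cast_smul_eq_nsmul]
    intro τ hτ
    rw [hx τ (by simpa using hτ), smul_smul, signIn_mul_self, one_smul]

end Antisymmetrizer

/-! ### Relabelling of Young symmetrizers and Garnir relations -/

section Relabel

variable {μ : YoungDiagram} {A : Type*}

theorem colOf_trans (T : YoungTableau μ A) (σ : Equiv.Perm A) (a : A) :
    colOf (T.trans σ) a = colOf T (σ⁻¹ a) := rfl

theorem mem_fibreSubgroup {f : A → ℕ} {σ : Equiv.Perm A} :
    σ ∈ fibreSubgroup f ↔ ∀ a, f (σ a) = f a := Iff.rfl

theorem mem_fibreSubgroup_comp {f : A → ℕ} {σ τ : Equiv.Perm A} :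
    τ ∈ fibreSubgroup (fun a => f (σ⁻¹ a)) ↔ σ⁻¹ * τ * σ ∈ fibreSubgroup f := by
  simp only [mem_fibreSubgroup, mul_apply]
  constructor
  · intro h a
    simpa using h (σ a)
  · intro h a
    simpa using h (σ⁻¹ a)

/-- The permutations supported on a set. -/
abbrev symOn (Z : Set A) : Subgroup (Equiv.Perm A) := fixingSubgroup (Equiv.Perm A) Zᶜ

theorem mem_symOn {Z : Set A} {σ : Equiv.Perm A} : σ ∈ symOn Z ↔ ∀ a ∉ Z, σ a = a := by
  simp [symOn, mem_fixingSubgroup_iff]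

/-- The boxes in the rows of column `j + 1` also occur in column `j`, so that more than
`#(column j)` entries of these two columns cannot lie in pairwise different rows. -/
theorem exists_rowOf_eq_of_card_lt [Fintype A] (T : YoungTableau μ A) {j : ℕ} {Z : Finset A}
    (hZ : ∀ i ∈ Z, colOf T i = j ∨ colOf T i = j + 1)
    (hcard : (Finset.univ.filter fun i => colOf T i = j).card < Z.card) {τ : Equiv.Perm A}
    (hτ : τ ∈ colSubgroup T) :
    ∃ i ∈ Z, ∃ i' ∈ Z, i ≠ i' ∧ rowOf T (τ i) = rowOf T (τ i') := by
  classical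
  have hbox : ∀ i ∈ Z, (rowOf T (τ i), j) ∈ μ := by
    intro i hi
    refine μ.up_left_mem le_rfl ?_ (T.symm (τ i)).2
    change j ≤ colOf T (τ i)
    rw [hτ i]
    rcases hZ i hi with h | h <;> omega
  -- Pigeonhole: slide the box of `τ i` horizontally into column `j`. The default `else i` never
  -- occurs on `Z`.
  obtain ⟨i, hi, i', hi', hne, h⟩ := Finset.exists_ne_map_eq_of_card_lt_of_maps_to
    (f := fun i => if h : (rowOf T (τ i), j) ∈ μ then T ⟨_, h⟩ else i) hcard (by
      intro i hi
      simp only [Finset.coe_filter, Finset.mem_univ, true_and, Set.mem_ofPred_eq]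
      rw [dif_pos (hbox i hi)]
      simp [colOf])
  refine ⟨i, hi, i', hi', hne, ?_⟩
  simp only [dif_pos (hbox i hi), dif_pos (hbox i' hi'), T.injective.eq_iff, Subtype.mk.injEq,
    Prod.mk.injEq, and_true] at h
  exact h

variable (K : Type*) [Field K] [Fintype A] [DecidableEq A]

theorem colAntisymmetrizer_eq (T : YoungTableau μ A) :
    colAntisymmetrizer K T = antisymmetrizer K (colSubgroup T) := rfl

theorem rowSymmetrizer_mul_single (T : YoungTableau μ A) (σ : Equiv.Perm A) :
    rowSymmetrizer K T * MonoidAlgebra.single σ 1 =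
      MonoidAlgebra.single σ 1 * rowSymmetrizer K (T.trans σ⁻¹) := by
  classical
  rw [rowSymmetrizer, rowSymmetrizer, Finset.sum_mul, Finset.mul_sum]
  refine Finset.sum_bij' (fun τ _ => σ⁻¹ * τ * σ) (fun τ _ => σ * τ * σ⁻¹) ?_ ?_ ?_ ?_ ?_
  · intro τ hτ
    simp only [Finset.mem_filter, Finset.mem_univ, true_and] at hτ ⊢
    change _ ∈ fibreSubgroup (fun a => rowOf T (σ⁻¹⁻¹ a))
    rw [mem_fibreSubgroup_comp]
    have h : σ⁻¹⁻¹ * (σ⁻¹ * τ * σ) * σ⁻¹ = τ := by group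
    rw [h]
    exact hτ
  · intro τ hτ
    simp only [Finset.mem_filter, Finset.mem_univ, true_and] at hτ ⊢
    change _ ∈ fibreSubgroup (fun a => rowOf T (σ⁻¹⁻¹ a)) at hτ
    rw [mem_fibreSubgroup_comp, inv_inv] at hτ
    exact hτ
  · intro τ _; group
  · intro τ _; group
  · intro τ _
    simp [MonoidAlgebra.single_mul_single, mul_assoc]

theorem colAntisymmetrizer_mul_single (T : YoungTableau μ A) (σ : Equiv.Perm A) :
    colAntisymmetrizer K T * MonoidAlgebra.single σ 1 =
      MonoidAlgebra.single σ 1 * colAntisymmetrizer K (T.trans σ⁻¹) := by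
  classical
  rw [colAntisymmetrizer, colAntisymmetrizer, Finset.sum_mul, Finset.mul_sum]
  refine Finset.sum_bij' (fun τ _ => σ⁻¹ * τ * σ) (fun τ _ => σ * τ * σ⁻¹) ?_ ?_ ?_ ?_ ?_
  · intro τ hτ
    simp only [Finset.mem_filter, Finset.mem_univ, true_and] at hτ ⊢
    change _ ∈ fibreSubgroup (fun a => colOf T (σ⁻¹⁻¹ a))
    rw [mem_fibreSubgroup_comp]
    have h : σ⁻¹⁻¹ * (σ⁻¹ * τ * σ) * σ⁻¹ = τ := by group
    rw [h]
    exact hτ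
  · intro τ hτ
    simp only [Finset.mem_filter, Finset.mem_univ, true_and] at hτ ⊢
    change _ ∈ fibreSubgroup (fun a => colOf T (σ⁻¹⁻¹ a)) at hτ
    rw [mem_fibreSubgroup_comp, inv_inv] at hτ
    exact hτ
  · intro τ _; group
  · intro τ _; group
  · intro τ _
    have h : signIn K (σ⁻¹ * τ * σ) = signIn K τ := by
      rw [signIn_mul, signIn_mul, signIn_inv, mul_right_comm, signIn_mul_self, one_mul]
    change MonoidAlgebra.single τ (signIn K τ) * _ =
      _ * MonoidAlgebra.single _ (signIn K (σ⁻¹ * τ * σ))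
    rw [h, MonoidAlgebra.single_mul_single, MonoidAlgebra.single_mul_single]
    simp [mul_assoc]

/-- Conjugation transports the row and column groups. This turns right multiplication into left
multiplication, which left ideals absorb, at the cost of changing the tableau. -/
theorem youngSymmetrizer_mul_single (T : YoungTableau μ A) (σ : Equiv.Perm A) :
    youngSymmetrizer K T * MonoidAlgebra.single σ 1 =
      MonoidAlgebra.single σ 1 * youngSymmetrizer K (T.trans σ⁻¹) := by
  rw [youngSymmetrizer, youngSymmetrizer, mul_assoc, colAntisymmetrizer_mul_single,
    ← mul_assoc, rowSymmetrizer_mul_single, mul_assoc]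

variable {K}

theorem youngSymmetrizer_mul_single_of_mem (T : YoungTableau μ A) {τ : Equiv.Perm A}
    (hτ : τ ∈ colSubgroup T) :
    youngSymmetrizer K T * MonoidAlgebra.single τ 1 = signIn K τ • youngSymmetrizer K T := by
  rw [youngSymmetrizer, mul_assoc, colAntisymmetrizer_eq, antisymmetrizer_mul_single hτ,
    mul_smul_comm]

theorem rowSymmetrizer_mul_single_of_mem (T : YoungTableau μ A) {σ : Equiv.Perm A}
    (hσ : σ ∈ rowSubgroup T) :
    rowSymmetrizer K T * MonoidAlgebra.single σ 1 = rowSymmetrizer K T := by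
  classical
  rw [rowSymmetrizer, Finset.sum_mul]
  refine Finset.sum_bij' (fun τ _ => τ * σ) (fun τ _ => τ * σ⁻¹) ?_ ?_ ?_ ?_ ?_
  · intro τ hτ
    simpa [Subgroup.mul_mem_cancel_right _ hσ] using hτ
  · intro τ hτ
    simpa [Subgroup.mul_mem_cancel_right _ (Subgroup.inv_mem _ hσ)] using hτ
  · simp
  · simp
  · intro τ _
    simp [MonoidAlgebra.single_mul_single]

/-- The Garnir relations. -/
theorem youngSymmetrizer_mul_antisymmetrizer_symOn [CharZero K] (T : YoungTableau μ A) {j : ℕ}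
    {Z : Finset A} (hZ : ∀ i ∈ Z, colOf T i = j ∨ colOf T i = j + 1)
    (hcard : (Finset.univ.filter fun i => colOf T i = j).card < Z.card) :
    youngSymmetrizer K T * antisymmetrizer K (symOn (Z : Set A)) = 0 := by
  classical
  rw [youngSymmetrizer, colAntisymmetrizer_eq, mul_assoc, antisymmetrizer_mul, Finset.mul_sum]
  refine Finset.sum_eq_zero fun τ hτ => ?_
  rw [mul_smul_comm]
  obtain ⟨i, hi, i', hi', hne, h⟩ := exists_rowOf_eq_of_card_lt T hZ hcard (by simpa using hτ)
  have hswap : Equiv.swap i i' ∈ symOn (Z : Set A) := by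
    rw [mem_symOn]
    intro a ha
    refine Equiv.swap_apply_of_ne_of_ne ?_ ?_ <;> rintro rfl <;> exact ha (by assumption)
  have hrow : Equiv.swap (τ i) (τ i') ∈ rowSubgroup T := by
    intro a
    rw [Equiv.swap_apply_def]
    split_ifs with h1 h2
    · rw [h1, h]
    · rw [h2, h]
    · rfl
  -- The transposition of `i` and `i'` acts by -1 on the antisymmetrizer; moved past `τ` it becomes
  -- a row transposition, which the row symmetrizer absorbs. Hence the term equals its own negative.
  have key : rowSymmetrizer K T * (MonoidAlgebra.single τ 1 *
      antisymmetrizer K (symOn (Z : Set A))) = -(rowSymmetrizer K T * (MonoidAlgebra.single τ 1 *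
      antisymmetrizer K (symOn (Z : Set A)))) := by
    have h1 := single_mul_antisymmetrizer (K := K) hswap
    rw [signIn, sign_swap hne] at h1
    simp only [Units.val_neg, Units.val_one, Int.cast_neg, Int.cast_one, neg_smul, one_smul] at h1
    conv_lhs => rw [← neg_neg (antisymmetrizer K (symOn (Z : Set A))), ← h1, mul_neg, mul_neg]
    rw [← mul_assoc (MonoidAlgebra.single τ 1), MonoidAlgebra.single_mul_single, mul_one,
      Equiv.mul_swap_eq_swap_mul, ← mul_one (1 : K), ← MonoidAlgebra.single_mul_single, mul_one,
      mul_assoc, ← mul_assoc (rowSymmetrizer K T), rowSymmetrizer_mul_single_of_mem T hrow]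
  rw [smul_eq_zero]
  right
  have h2 : (2 : K) • (rowSymmetrizer K T * (MonoidAlgebra.single τ 1 *
      antisymmetrizer K (symOn (Z : Set A)))) = 0 := by
    rw [two_smul]
    exact add_eq_zero_iff_eq_neg.mpr key
  exact (smul_eq_zero.mp h2).resolve_left two_ne_zero

end Relabel

/-! ### Permutations with prescribed fibres -/

section PermExistence

variable {A : Type*} [Fintype A]

theorem exists_perm_of_card_fibre_eq {γ : Type*} [DecidableEq γ] {f g : A → γ}
    (h : ∀ c, (Finset.univ.filter fun a => f a = c).card =
      (Finset.univ.filter fun a => g a = c).card) :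
    ∃ ρ : Equiv.Perm A, ∀ a, g (ρ a) = f a := by
  have e : ∀ c, Nonempty ({a // f a = c} ≃ {a // g a = c}) := fun c =>
    ⟨Fintype.equivOfCardEq (by rw [Fintype.card_subtype, Fintype.card_subtype, h c])⟩
  exact ⟨Equiv.ofFiberEquiv fun c => (e c).some, fun a => Equiv.ofFiberEquiv_map _ a⟩

theorem card_filter_perm_comp (p : A → Prop) [DecidablePred p] (π : Equiv.Perm A) :
    (Finset.univ.filter fun a => p (π a)).card = (Finset.univ.filter p).card := by
  rw [← Fintype.card_subtype, ← Fintype.card_subtype]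
  exact Fintype.card_congr (π.subtypeEquiv fun _ => Iff.rfl)

/-- A permutation that preserves the fibres of `g` outside `F` can be replaced by one supported
on `F`, with the same effect on the values of `g`. -/
theorem exists_mem_symOn_comp_eq {γ : Type*} {g : A → γ} (π : Equiv.Perm A) {F : Set A}
    (h : ∀ a ∉ F, g (π a) = g a) : ∃ ρ ∈ symOn F, ∀ a, g (ρ a) = g (π a) := by
  classical
  -- The second component tags each letter outside `F` by itself, which forces `ρ` to fix it;
  -- letters of `F` share the tag `none`.
  obtain ⟨ρ, hρ⟩ := exists_perm_of_card_fibre_eq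
    (f := fun a => (g (π a), if a ∈ F then none else some a))
    (g := fun a => (g a, if a ∈ F then none else some a)) (by
      rintro ⟨c, _ | i⟩
      · have h1 := card_filter_perm_comp (fun a => g a = c) π
        rw [← Finset.card_filter_add_card_filter_not (s := Finset.univ.filter fun a => g (π a) = c)
          (· ∈ F), ← Finset.card_filter_add_card_filter_not
          (s := Finset.univ.filter fun a => g a = c) (· ∈ F), Finset.filter_filter,
          Finset.filter_filter, Finset.filter_filter, Finset.filter_filter] at h1
        have h2 : (Finset.univ.filter fun a => g (π a) = c ∧ a ∉ F) =
            Finset.univ.filter fun a => g a = c ∧ a ∉ F := by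
          refine Finset.filter_congr fun a _ => and_congr_left fun ha => ?_
          rw [h a ha]
        rw [h2] at h1
        have h3 : ∀ f : A → γ, (Finset.univ.filter fun a =>
            (f a, if a ∈ F then none else some a) = (c, none)) =
            Finset.univ.filter fun a => f a = c ∧ a ∈ F := by
          intro f
          refine Finset.filter_congr fun a _ => ?_
          by_cases ha : a ∈ F <;> simp [ha]
        rw [h3 g, h3 fun a => g (π a)]
        omega
      · congr 1
        refine Finset.filter_congr fun a _ => ?_
        by_cases ha : a ∈ F <;> simp [ha, h])
  refine ⟨ρ, ?_, fun a => congrArg Prod.fst (hρ a)⟩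
  rw [mem_symOn]
  intro a ha
  have h1 := congrArg Prod.snd (hρ a)
  simp only [ha, if_false] at h1
  split_ifs at h1
  exact Option.some.inj h1

end PermExistence

theorem mul_mem_of_mul_single_mem
    {A : Type*} {K : Type*} [Field K] {G : Submodule K (MonoidAlgebra K (Equiv.Perm A))}
    (hG : ∀ x ∈ G, ∀ σ : Equiv.Perm A, x * MonoidAlgebra.single σ 1 ∈ G)
    {x : MonoidAlgebra K (Equiv.Perm A)} (hx : x ∈ G) (y : MonoidAlgebra K (Equiv.Perm A)) :
    x * y ∈ G := by
  induction y using MonoidAlgebra.induction_linear with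
  | zero => simp
  | add y z hy hz => rw [mul_add]; exact G.add_mem hy hz
  | single σ c =>
    have h : MonoidAlgebra.single σ c = c • MonoidAlgebra.single σ (1 : K) := by simp
    rw [h, mul_smul_comm]
    exact G.smul_mem _ (hG x hx σ)

/-! ### Garnir ideals and the exchange step -/

section Straightening

variable {A : Type*} [Fintype A] [DecidableEq A] {K : Type*} [Field K]

/-- The right ideals of the group algebra that contain the relations satisfied by the Young
symmetrizer of a tableau with the given columns: column antisymmetry and Garnir relations. -/
structure IsGarnirIdeal (col : A → ℕ) (G : Submodule K (MonoidAlgebra K (Equiv.Perm A))) :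
    Prop where
  mul_single_mem : ∀ x ∈ G, ∀ σ : Equiv.Perm A, x * MonoidAlgebra.single σ 1 ∈ G
  antisymm : ∀ τ ∈ fibreSubgroup col, MonoidAlgebra.single τ 1 - signIn K τ • 1 ∈ G
  garnir : ∀ (j : ℕ) (Z : Finset A), (∀ i ∈ Z, col i = j ∨ col i = j + 1) →
    (Finset.univ.filter fun i => col i = j).card < Z.card →
    antisymmetrizer K (symOn (Z : Set A)) ∈ G

variable {col : A → ℕ} {G : Submodule K (MonoidAlgebra K (Equiv.Perm A))}

/-- One exchange step: a Garnir relation expresses `σ₀ * antisymmetrizer H` through the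
permutations which change the column of some entry outside `F`. -/
theorem single_mul_antisymmetrizer_mem_of_exchange [CharZero K]
    (hmul : ∀ x ∈ G, ∀ σ : Equiv.Perm A, x * MonoidAlgebra.single σ 1 ∈ G)
    (hanti : ∀ τ ∈ fibreSubgroup col, MonoidAlgebra.single τ 1 - signIn K τ • 1 ∈ G)
    {σ₀ : Equiv.Perm A} {Z : Set A}
    (hZ : MonoidAlgebra.single σ₀ 1 * antisymmetrizer K (symOn Z) ∈ G)
    {F : Set A} {H : Subgroup (Equiv.Perm A)} (hF : symOn F ≤ H) :
    MonoidAlgebra.single σ₀ 1 * antisymmetrizer K H ∈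
      Submodule.span K {x | ∃ σ ∈ symOn Z, (∃ i ∉ F, col (σ₀ (σ i)) ≠ col (σ₀ i)) ∧
        x = MonoidAlgebra.single (σ₀ * σ) 1 * antisymmetrizer K H} ⊔ G := by
  classical
  set W := Submodule.span K {x | ∃ σ ∈ symOn Z, (∃ i ∉ F, col (σ₀ (σ i)) ≠ col (σ₀ i)) ∧
        x = MonoidAlgebra.single (σ₀ * σ) 1 * antisymmetrizer K H} ⊔ G with hW
  have hsum := mul_mem_of_mul_single_mem hmul hZ (antisymmetrizer K H)
  rw [mul_antisymmetrizer (MonoidAlgebra.single σ₀ 1) (symOn Z), Finset.sum_mul] at hsum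
  set N : Equiv.Perm A → Prop := fun σ => ∀ i ∉ F, col (σ₀ (σ i)) = col (σ₀ i) with hN
  have hterm : ∀ σ ∈ Finset.univ.filter (· ∈ symOn Z),
      signIn K σ • (MonoidAlgebra.single σ₀ 1 * MonoidAlgebra.single σ 1) * antisymmetrizer K H -
        (if N σ then MonoidAlgebra.single σ₀ 1 * antisymmetrizer K H else 0) ∈ W := by
    intro σ hσ
    rw [MonoidAlgebra.single_mul_single, mul_one, smul_mul_assoc]
    split_ifs with hn
    -- Here σ₀σ = τσ₀ρ with `τ` column-preserving and `ρ` in `H`. Both act by their signs modulo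
    -- `G`, so after weighting by the sign of `σ` the term is congruent to the one of σ = 1.
    · obtain ⟨ρ, hρF, hρ⟩ := exists_mem_symOn_comp_eq (g := fun a => col (σ₀ a)) σ hn
      refine Submodule.mem_sup_right ?_
      have hτ : σ₀ * σ * ρ⁻¹ * σ₀⁻¹ ∈ fibreSubgroup col := by
        intro a
        have := hρ (ρ⁻¹ (σ₀⁻¹ a))
        simpa using this.symm
      have h1 := mul_mem_of_mul_single_mem hmul (hanti _ hτ)
        (MonoidAlgebra.single (σ₀ * ρ) 1 * antisymmetrizer K H)
      have e1 : MonoidAlgebra.single (σ₀ * ρ) (1 : K) * antisymmetrizer K H =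
          signIn K ρ • (MonoidAlgebra.single σ₀ 1 * antisymmetrizer K H) := by
        rw [← mul_smul_comm, ← single_mul_antisymmetrizer (hF hρF), ← mul_assoc,
          MonoidAlgebra.single_mul_single, mul_one]
      have e2 : σ₀ * σ * ρ⁻¹ * σ₀⁻¹ * (σ₀ * ρ) = σ₀ * σ := by group
      rw [sub_mul, ← mul_assoc (MonoidAlgebra.single _ _), MonoidAlgebra.single_mul_single, e2,
        mul_one, smul_mul_assoc, one_mul, e1, smul_smul] at h1
      have e3 : signIn K (σ₀ * σ * ρ⁻¹ * σ₀⁻¹) * signIn K ρ = signIn K σ := by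
        simp only [signIn_mul, signIn_inv]
        linear_combination (signIn K ρ * signIn K ρ) * signIn K σ * signIn_mul_self K σ₀ +
          signIn K σ * signIn_mul_self K ρ
      rw [e3] at h1
      have h2 := G.smul_mem (signIn K σ) h1
      rw [smul_sub, smul_smul, signIn_mul_self, one_smul] at h2
      exact h2
    · rw [sub_zero]
      refine W.smul_mem _ (Submodule.mem_sup_left (Submodule.subset_span ⟨σ, by simpa using hσ, ?_,
        rfl⟩))
      simpa [hN] using hn
  have h1 := W.sum_mem hterm
  rw [Finset.sum_sub_distrib] at h1
  have h2 := (W.sub_mem_iff_right (Submodule.mem_sup_right hsum)).mp h1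
  -- The equal terms add up to their number times σ₀ · A_H. The identity is among them, so this
  -- number is invertible in characteristic zero.
  rw [← Finset.sum_filter, Finset.sum_const, ← Nat.cast_smul_eq_nsmul K] at h2
  refine (W.smul_mem_iff ?_).mp h2
  rw [Nat.cast_ne_zero]
  refine Finset.card_ne_zero_of_mem (a := 1) ?_
  simp [hN]

/-- The semistandardness condition for a filling with columns `c` and labels `ℓ`, in terms of the
numbers of small labels in neighbouring columns. -/
def IsSemistandard (c ℓ : A → ℕ) : Prop :=
  ∀ j a, (Finset.univ.filter fun i => c i = j + 1 ∧ ℓ i ≤ a).card ≤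
    (Finset.univ.filter fun i => c i = j ∧ ℓ i < a).card

end Straightening

/-! ### Semistandard labelled fillings -/

section Semistandard

variable {A : Type*} [Fintype A] {c ℓ : A → ℕ}

/-- In sorted columns semistandardness means that labels increase strictly along rows. With columns
counted from 0, a label in column `j` has `j` smaller labels before it. -/
theorem IsSemistandard.le (h : IsSemistandard c ℓ) (i : A) : c i ≤ ℓ i := by
  suffices ∀ j, ∀ i, c i = j → j ≤ ℓ i from this _ i rfl
  intro j
  induction j with
  | zero => intro i _; exact Nat.zero_le _
  | succ j ih =>
    intro i hi
    have h1 := h j (ℓ i)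
    have h2 : 0 < (Finset.univ.filter fun i' => c i' = j + 1 ∧ ℓ i' ≤ ℓ i).card :=
      Finset.card_pos.mpr ⟨i, by simp [hi]⟩
    obtain ⟨i', hi'⟩ := Finset.card_pos.mp (h2.trans_le h1)
    simp only [Finset.mem_filter, Finset.mem_univ, true_and] at hi'
    have := ih i' hi'.1
    omega

/-- The labels below `b` occupy initial segments of the rows, hence a Young diagram once the columns
are sorted. -/
theorem IsSemistandard.antitone (h : IsSemistandard c ℓ) (b : ℕ) :
    Antitone fun j => (Finset.univ.filter fun i => c i = j ∧ ℓ i < b).card := by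
  refine antitone_nat_of_succ_le fun j => ?_
  rcases b with _ | b
  · simp
  refine le_trans ?_ ((h j b).trans ?_)
  · exact Finset.card_le_card fun i hi => by simpa [Nat.lt_succ_iff] using hi
  · refine Finset.card_le_card fun i hi => ?_
    simp only [Finset.mem_filter, Finset.mem_univ, true_and] at hi ⊢
    exact ⟨hi.1, by omega⟩

theorem IsSemistandard.comp_perm (h : IsSemistandard c ℓ) {ρ : Equiv.Perm A}
    (hρ : ρ ∈ fibreSubgroup ℓ) : IsSemistandard (fun i => c (ρ i)) ℓ := by
  intro j a
  have h1 := card_filter_perm_comp (fun i => c i = j + 1 ∧ ℓ i ≤ a) ρ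
  have h2 := card_filter_perm_comp (fun i => c i = j ∧ ℓ i < a) ρ
  simp only [mem_fibreSubgroup.mp hρ] at h1 h2
  rw [h1, h2]
  exact h j a

end Semistandard

/-- An exchange between two neighbouring columns that moves the labels above `a` to the right and
those below `a` to the left. -/
theorem sum_col_mul_le_of_exchange {A : Type*} [Fintype A] {col : A → ℕ} {σ₀ σ : Equiv.Perm A} {ℓ : A → ℕ} {a : ℕ} {u : ℕ → ℤ}
    (hu : Monotone u) (hlt : ∀ i, ℓ i < a → col (σ₀ (σ i)) ≤ col (σ₀ i))
    (hgt : ∀ i, a < ℓ i → col (σ₀ i) ≤ col (σ₀ (σ i))) :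
    (∀ i, 0 ≤ ((col (σ₀ (σ i)) : ℤ) - col (σ₀ i)) * (u (ℓ i) - u a)) ∧
    ∑ i, ((col (σ₀ (σ i)) : ℤ) - col (σ₀ i)) * (u (ℓ i) - u a) =
      ∑ i, (col (σ₀ (σ i)) : ℤ) * u (ℓ i) - ∑ i, (col (σ₀ i) : ℤ) * u (ℓ i) := by
  constructor
  · intro i
    rcases lt_trichotomy (ℓ i) a with h | h | h
    · exact mul_nonneg_of_nonpos_of_nonpos (by have := hlt i h; omega)
        (sub_nonpos.mpr (hu h.le))
    · simp [h]
    · exact mul_nonneg (by have := hgt i h; omega) (sub_nonneg.mpr (hu h.le))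
  · have h : ∑ i, (col (σ₀ (σ i)) : ℤ) = ∑ i, (col (σ₀ i) : ℤ) :=
      Equiv.sum_comp σ fun i => (col (σ₀ i) : ℤ)
    simp only [sub_mul, mul_sub, Finset.sum_sub_distrib, ← Finset.sum_mul, h]
    ring

/-! ### The straightening algorithm -/

section Straightening

variable {A : Type*} [Fintype A] [DecidableEq A] {K : Type*} [Field K]
variable {col : A → ℕ} {G : Submodule K (MonoidAlgebra K (Equiv.Perm A))}

theorem single_mul_antisymmetrizer_symOn_mem (hG : IsGarnirIdeal col G) {σ : Equiv.Perm A}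
    {j : ℕ} {Z : Finset A} (hZ : ∀ i ∈ Z, col (σ i) = j ∨ col (σ i) = j + 1)
    (hcard : (Finset.univ.filter fun i => col (σ i) = j).card < Z.card) :
    MonoidAlgebra.single σ 1 * antisymmetrizer K (symOn (Z : Set A)) ∈ G := by
  classical
  have h1 := hG.garnir j (Z.map σ.toEmbedding) (by
      intro i hi
      obtain ⟨i', hi', rfl⟩ := Finset.mem_map.mp hi
      exact hZ i' hi') (by
      rw [Finset.card_map, ← card_filter_perm_comp _ σ]
      exact hcard)
  have h2 := hG.mul_single_mem _ h1 σ
  convert h2 using 1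
  rw [antisymmetrizer, antisymmetrizer, Finset.sum_mul, Finset.mul_sum]
  refine Finset.sum_bij' (fun τ _ => σ * τ * σ⁻¹) (fun τ _ => σ⁻¹ * τ * σ) ?_ ?_ ?_ ?_ ?_
  · intro τ hτ
    simp only [Finset.mem_filter, Finset.mem_univ, true_and, mem_symOn] at hτ ⊢
    intro a ha
    simp only [mul_apply]
    rw [hτ]
    · simp
    · intro h
      exact ha (Finset.mem_map.mpr ⟨σ⁻¹ a, h, by simp⟩)
  · intro τ hτ
    simp only [Finset.mem_filter, Finset.mem_univ, true_and, mem_symOn] at hτ ⊢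
    intro a ha
    simp only [mul_apply]
    rw [hτ]
    · simp
    · simpa using ha
  · intro τ _; group
  · intro τ _; group
  · intro τ _
    have h : signIn K (σ * τ * σ⁻¹) = signIn K τ := by
      rw [signIn_mul, signIn_mul, signIn_inv, mul_right_comm, signIn_mul_self, one_mul]
    rw [h, MonoidAlgebra.single_mul_single, MonoidAlgebra.single_mul_single]
    simp

/-- Straightening of labelled fillings. -/
theorem single_mul_antisymmetrizer_mem_semistandard [CharZero K] (hG : IsGarnirIdeal col G)
    {ℓ : A → ℕ} {H : Subgroup (Equiv.Perm A)} (hH : ∀ a, symOn {i | ℓ i = a} ≤ H)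
    (b : ℕ) (σ : Equiv.Perm A) :
    MonoidAlgebra.single σ 1 * antisymmetrizer K H ∈
      Submodule.span K {x | ∃ σ' : Equiv.Perm A, IsSemistandard (fun i => col (σ' i)) ℓ ∧
        ∑ i with ℓ i < b, col (σ' i) ≤ ∑ i with ℓ i < b, col (σ i) ∧
        x = MonoidAlgebra.single σ' 1 * antisymmetrizer K H} ⊔ G := by
  classical
  -- Termination: each exchange strictly increases ∑ column · label, which is bounded because there
  -- are finitely many permutations.
  obtain ⟨M, hM⟩ : ∃ M : ℕ, ∀ σ : Equiv.Perm A, ∑ i, col (σ i) * ℓ i ≤ M :=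
    ⟨_, fun σ => Finset.single_le_sum (f := fun σ : Equiv.Perm A => ∑ i, col (σ i) * ℓ i)
      (fun _ _ => Nat.zero_le _) (Finset.mem_univ σ)⟩
  induction hs : M - ∑ i, col (σ i) * ℓ i using Nat.strong_induction_on generalizing σ with
  | _ s ih =>
  by_cases hss : IsSemistandard (fun i => col (σ i)) ℓ
  · exact Submodule.mem_sup_left (Submodule.subset_span ⟨σ, hss, le_rfl, rfl⟩)
  simp only [IsSemistandard, not_forall, not_le] at hss
  obtain ⟨j, a, hja⟩ := hss
  -- At a violation, the labels at least `a` in column `j` and those at most `a` in column `j + 1`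
  -- outnumber column `j`, so a Garnir relation applies. Taking `F` to be the letters labelled `a`,
  -- every remaining term moves some other label, larger ones only right and smaller ones only left.
  set X := Finset.univ.filter fun i => col (σ i) = j ∧ a ≤ ℓ i with hX
  set Y := Finset.univ.filter fun i => col (σ i) = j + 1 ∧ ℓ i ≤ a with hY
  have hXY : Disjoint X Y := by
    rw [Finset.disjoint_left]
    intro i hi hi'
    simp only [hX, hY, Finset.mem_filter, Finset.mem_univ, true_and] at hi hi'
    omega
  have hZ : ∀ i ∈ X ∪ Y, col (σ i) = j ∨ col (σ i) = j + 1 := by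
    intro i hi
    simp only [hX, hY, Finset.mem_union, Finset.mem_filter, Finset.mem_univ, true_and] at hi
    omega
  have hcard : (Finset.univ.filter fun i => col (σ i) = j).card < (X ∪ Y).card := by
    rw [Finset.card_union_of_disjoint hXY,
      ← Finset.card_filter_add_card_filter_not (s := Finset.univ.filter fun i => col (σ i) = j)
        (fun i => a ≤ ℓ i), Finset.filter_filter, Finset.filter_filter]
    simp only [not_le]
    exact Nat.add_lt_add_left hja _
  have hstep := single_mul_antisymmetrizer_mem_of_exchange hG.mul_single_mem hG.antisymm
    (single_mul_antisymmetrizer_symOn_mem hG hZ hcard) (hH a)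
  refine SetLike.le_def.mp (sup_le (Submodule.span_le.mpr ?_) le_sup_right) hstep
  rintro _ ⟨τ, hτ, ⟨i₀, hi₀, hne⟩, rfl⟩
  rw [mem_symOn] at hτ
  have hτZ : ∀ i ∈ X ∪ Y, τ i ∈ X ∪ Y := by
    intro i hi
    by_contra h
    have h1 := hτ (τ i) (by simpa using h)
    rw [τ.injective h1] at h
    exact h hi
  have hlt : ∀ i, ℓ i < a → col (σ (τ i)) ≤ col (σ i) := by
    intro i hi
    by_cases hiZ : i ∈ X ∪ Y
    · have h1 := hZ _ (hτZ i hiZ)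
      simp only [hX, hY, Finset.mem_union, Finset.mem_filter, Finset.mem_univ, true_and] at hiZ
      omega
    · rw [hτ i (by simpa using hiZ)]
  have hgt : ∀ i, a < ℓ i → col (σ i) ≤ col (σ (τ i)) := by
    intro i hi
    by_cases hiZ : i ∈ X ∪ Y
    · have h1 := hZ _ (hτZ i hiZ)
      simp only [hX, hY, Finset.mem_union, Finset.mem_filter, Finset.mem_univ, true_and] at hiZ
      omega
    · rw [hτ i (by simpa using hiZ)]
  have hinc : ∑ i, col (σ i) * ℓ i < ∑ i, col (σ (τ i)) * ℓ i := by
    obtain ⟨h1, h2⟩ := sum_col_mul_le_of_exchange (col := col) (σ₀ := σ) (σ := τ) (ℓ := ℓ) (a := a)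
      (u := fun x => (x : ℤ)) Nat.mono_cast hlt hgt
    have h3 : 0 < ∑ i, ((col (σ (τ i)) : ℤ) - col (σ i)) * ((ℓ i : ℤ) - a) := by
      refine Finset.sum_pos' (fun i _ => h1 i) ⟨i₀, Finset.mem_univ _, ?_⟩
      refine lt_of_le_of_ne (h1 i₀) (Ne.symm (mul_ne_zero ?_ ?_))
      · exact sub_ne_zero.mpr (by exact_mod_cast hne)
      · exact sub_ne_zero.mpr (by exact_mod_cast hi₀)
    rw [h2] at h3
    zify
    linarith
  have hdec : ∑ i with ℓ i < b, col (σ (τ i)) ≤ ∑ i with ℓ i < b, col (σ i) := by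
    obtain ⟨h1, h2⟩ := sum_col_mul_le_of_exchange (col := col) (σ₀ := σ) (σ := τ) (ℓ := ℓ) (a := a)
      -- This monotone weight turns the general inequality into control of the columns of the labels
      -- below `b`.
      (u := fun x => if x < b then -1 else 0) (by
        intro x y hxy
        dsimp only
        split_ifs <;> omega) hlt hgt
    have h3 := Finset.sum_nonneg fun i (_ : i ∈ Finset.univ) => h1 i
    rw [h2] at h3
    simp only [mul_ite, mul_neg, mul_one, mul_zero, ← Finset.sum_filter,
      Finset.sum_neg_distrib] at h3
    rw [← Nat.cast_le (α := ℤ), Nat.cast_sum, Nat.cast_sum]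
    linarith
  have hM' := hM (σ * τ)
  simp only [mul_apply] at hM'
  have h1 := ih _ (by simp only [mul_apply]; omega) (σ * τ) rfl
  refine SetLike.le_def.mp (sup_le (Submodule.span_le.mpr ?_) le_sup_right) h1
  rintro _ ⟨σ', h1, h2, rfl⟩
  exact Submodule.mem_sup_left (Submodule.subset_span ⟨σ', h1, h2.trans hdec, rfl⟩)

end Straightening

theorem perm_apply_inv {A : Type*} (π : Equiv.Perm A) (a : A) : π (π⁻¹ a) = a :=
  π.apply_symm_apply a

theorem perm_inv_apply {A : Type*} (π : Equiv.Perm A) (a : A) : π⁻¹ (π a) = a :=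
  π.symm_apply_apply a

/-! ### The embedding of K[S_k] and invariant right ideals -/

section Embed

/-- The embedding of `S_k` into `S_{k+m}` as the permutations of the first `k` letters. -/
def embedPerm (k m : ℕ) : Equiv.Perm (Fin k) →* Equiv.Perm (Fin (k + m)) where
  toFun σ := concatPerm σ 1
  map_one' := by
    ext i
    refine Fin.addCases (fun i => ?_) (fun i => ?_) i
    · rw [concatPerm_castAdd]; rfl
    · rw [concatPerm_natAdd]; rfl
  map_mul' σ τ := by
    ext i
    refine Fin.addCases (fun i => ?_) (fun i => ?_) i
    · simp only [mul_apply, concatPerm_castAdd]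
    · simp only [mul_apply, concatPerm_natAdd, one_apply]

variable {k m : ℕ}

@[simp]
theorem embedPerm_castAdd (σ : Equiv.Perm (Fin k)) (i : Fin k) :
    embedPerm k m σ (Fin.castAdd m i) = Fin.castAdd m (σ i) := concatPerm_castAdd σ 1 i

@[simp]
theorem embedPerm_natAdd (σ : Equiv.Perm (Fin k)) (i : Fin m) :
    embedPerm k m σ (Fin.natAdd k i) = Fin.natAdd k i := concatPerm_natAdd σ 1 i

theorem embedPerm_injective : Function.Injective (embedPerm k m) := by
  intro σ τ h
  ext i
  have := congrArg (fun π => π (Fin.castAdd m i)) h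
  simpa [Fin.ext_iff] using this

theorem signIn_embedPerm (K : Type*) [Field K] (σ : Equiv.Perm (Fin k)) :
    signIn K (embedPerm k m σ) = signIn K σ := by
  have h : sign (embedPerm k m σ) = sign σ := by
    change sign (finSumFinEquiv.permCongr (Equiv.sumCongr σ 1)) = sign σ
    rw [sign_permCongr]
    change sign (sumCongr σ 1) = sign σ
    rw [sign_sumCongr, Equiv.Perm.sign_one, mul_one]
  rw [signIn, h, signIn]

theorem exists_embedPerm_eq {ρ : Equiv.Perm (Fin (k + m))}
    (h : ∀ i : Fin m, ρ (Fin.natAdd k i) = Fin.natAdd k i) : ∃ σ, embedPerm k m σ = ρ := by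
  have hlt : ∀ π : Equiv.Perm (Fin (k + m)), (∀ i : Fin m, π (Fin.natAdd k i) = Fin.natAdd k i) →
      ∀ i : Fin k, (π (Fin.castAdd m i)).val < k := by
    intro π hπ i
    by_contra hi
    have h1 := hπ ⟨(π (Fin.castAdd m i)).val - k, by omega⟩
    have h2 : Fin.natAdd k ⟨(π (Fin.castAdd m i)).val - k, by omega⟩ = π (Fin.castAdd m i) := by
      ext
      simp only [Fin.val_natAdd]
      omega
    rw [h2] at h1
    have h3 := congrArg Fin.val (π.injective h1)
    simp only [Fin.val_castAdd] at h3
    omega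
  have hinv : ∀ i : Fin m, ρ⁻¹ (Fin.natAdd k i) = Fin.natAdd k i := by
    intro i
    rw [inv_eq_iff_eq, h i]
  refine ⟨⟨fun i => ⟨_, hlt ρ h i⟩, fun i => ⟨_, hlt ρ⁻¹ hinv i⟩, ?_, ?_⟩, ?_⟩
  · intro i
    ext
    have : Fin.castAdd m ⟨_, hlt ρ h i⟩ = ρ (Fin.castAdd m i) := rfl
    simp only [this, perm_inv_apply]
    rfl
  · intro i
    ext
    have : Fin.castAdd m ⟨_, hlt ρ⁻¹ hinv i⟩ = ρ⁻¹ (Fin.castAdd m i) := rfl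
    simp only [this, perm_apply_inv]
    rfl
  · ext i
    refine Fin.addCases (fun i => ?_) (fun i => ?_) i
    · rw [embedPerm_castAdd]; rfl
    · rw [embedPerm_natAdd, h]

variable (K : Type*) [Field K]

/-- The embedding `K[S_k] → K[S_{k+m}]`. -/
noncomputable def embedAlg (k m : ℕ) :
    MonoidAlgebra K (Equiv.Perm (Fin k)) →ₐ[K] MonoidAlgebra K (Equiv.Perm (Fin (k + m))) :=
  MonoidAlgebra.mapDomainAlgHom K K (embedPerm k m)

@[simp]
theorem embedAlg_single (σ : Equiv.Perm (Fin k)) (c : K) :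
    embedAlg K k m (MonoidAlgebra.single σ c) = MonoidAlgebra.single (embedPerm k m σ) c := by
  simp [embedAlg, MonoidAlgebra.mapDomainAlgHom, MonoidAlgebra.mapDomainRingHom]

theorem embedAlg_antisymmetrizer (H : Subgroup (Equiv.Perm (Fin k))) :
    embedAlg K k m (antisymmetrizer K H) = antisymmetrizer K (H.map (embedPerm k m)) := by
  classical
  rw [antisymmetrizer, antisymmetrizer, map_sum]
  refine Finset.sum_bij (fun σ _ => embedPerm k m σ) ?_ ?_ ?_ ?_
  · intro σ hσ
    simpa using ⟨σ, by simpa using hσ, rfl⟩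
  · intro σ _ τ _ h
    exact embedPerm_injective h
  · intro π hπ
    simpa using hπ
  · intro σ _
    rw [embedAlg_single, signIn_embedPerm]

theorem concat_one (x : Component K k) : concat K k m x 1 = embedAlg K k m x := by
  induction x using MonoidAlgebra.induction_linear with
  | zero => simp
  | add x y hx hy => rw [map_add, map_add, LinearMap.add_apply, hx, hy]
  | single σ c =>
    rw [embedAlg_single, concat, LinearMap.mk₂_apply, Finset.sum_eq_single σ,
      Finset.sum_eq_single 1]
    · simp [embedPerm]
    · intro τ _ hτ
      simp [MonoidAlgebra.one_def, hτ.symm]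
    · simp
    · intro τ _ hτ
      simp [hτ.symm]
    · simp

variable {K}

/-- Embedding is right multiplication, in the generic tensor algebra, by the identity permutation of
degree `m`. -/
theorem incl_mul_embedAlg_mem {I : Submodule K (GenericTensorAlgebra K)}
    (hI : IsHomogeneousInvariantRightIdeal I) {x : Component K k} (hx : incl K k x ∈ I) :
    incl K (k + m) (embedAlg K k m x) ∈ I := by
  have h := hI.mul_mem _ hx (incl K m 1)
  simpa [genMul, concat_one] using h

/-- The degree `n` component of a homogeneous invariant right ideal, as a left ideal. -/
noncomputable def componentIdeal {I : Submodule K (GenericTensorAlgebra K)}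
    (hI : IsHomogeneousInvariantRightIdeal I) (n : ℕ) : Ideal (Component K n) where
  carrier := {x | incl K n x ∈ I}
  add_mem' := by
    intro x y hx hy
    change incl K n (x + y) ∈ I
    rw [map_add]
    exact I.add_mem hx hy
  zero_mem' := by
    change incl K n 0 ∈ I
    rw [map_zero]
    exact I.zero_mem
  smul_mem' a x hx := hI.left_mul_mem n a x hx

end Embed

/-! ### Subtableaux formed by the small entries -/

section Subtableau

variable {lam delta : YoungDiagram} {k m : ℕ} {h : delta ≤ lam}
  {S : YoungTableau delta (Fin k)} {T : YoungTableau lam (Fin (k + m))}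

theorem IsSubtableau.symm_castAdd (hST : IsSubtableau h (Nat.le_add_right k m) S T) (i : Fin k) :
    (T.symm (Fin.castAdd m i)).1 = (S.symm i).1 := by
  have h1 := hST (S.symm i)
  rw [Equiv.apply_symm_apply] at h1
  have h2 : T.symm (Fin.castAdd m i) = ⟨(S.symm i).1, h (S.symm i).2⟩ := by
    rw [Equiv.symm_apply_eq, h1]
    rfl
  rw [h2]

theorem IsSubtableau.colOf_castAdd (hST : IsSubtableau h (Nat.le_add_right k m) S T) (i : Fin k) :
    colOf T (Fin.castAdd m i) = colOf S i := by
  rw [colOf, hST.symm_castAdd, colOf]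

variable (T)

theorem card_colOf_le_colLen :
    (Finset.univ.filter fun i => colOf T i = j).card ≤ lam.colLen j := by
  rw [← Finset.card_range (lam.colLen j)]
  refine Finset.card_le_card_of_injOn (rowOf T) ?_ ?_
  · intro i hi
    simp only [Finset.coe_filter, Finset.mem_univ, true_and, Set.mem_ofPred_eq] at hi
    subst hi
    rw [Finset.coe_range]
    exact YoungDiagram.mem_iff_lt_colLen.mp (T.symm i).2
  · intro i hi i' hi' hr
    simp only [Finset.coe_filter, Finset.mem_univ, true_and, Set.mem_ofPred_eq] at hi hi'
    exact T.symm.injective (Subtype.ext (Prod.ext hr (hi.trans hi'.symm)))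

theorem card_colOf_rowOf_lt {j d : ℕ} (hd : d ≤ lam.colLen j) :
    (Finset.univ.filter fun i => colOf T i = j ∧ rowOf T i < d).card = d := by
  conv_rhs => rw [← Finset.card_range d]
  have hmem : ∀ r ∈ Finset.range d, (r, j) ∈ lam := fun r hr =>
    YoungDiagram.mem_iff_lt_colLen.mpr ((Finset.mem_range.mp hr).trans_le hd)
  refine (Finset.card_bij (fun r hr => T ⟨(r, j), hmem r hr⟩) ?_ ?_ ?_).symm
  · intro r hr
    refine Finset.mem_filter.mpr ⟨Finset.mem_univ _, ?_, ?_⟩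
    · rw [colOf, Equiv.symm_apply_apply]
    · rw [rowOf, Equiv.symm_apply_apply]
      exact Finset.mem_range.mp hr
  · intro r hr r' hr' he
    simpa using he
  · intro i hi
    simp only [Finset.mem_filter, Finset.mem_univ, true_and] at hi
    refine ⟨rowOf T i, by simpa using hi.2, ?_⟩
    rw [← Equiv.eq_symm_apply]
    exact Subtype.ext (Prod.ext rfl hi.1.symm)

/-- If the numbers of entries at most `k` in the columns decrease, these entries can be moved by a
column permutation to the boxes of a Young diagram. -/
theorem exists_isSubtableau_of_antitone
    (hd : Antitone fun j => (Finset.univ.filter fun i => colOf T i = j ∧ i.val < k).card) :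
    ∃ τ ∈ colSubgroup T, ∃ (delta : YoungDiagram) (h : delta ≤ lam)
      (S : YoungTableau delta (Fin k)),
      IsSubtableau h (Nat.le_add_right k m) S (T.trans τ⁻¹) := by
  classical
  set d : ℕ → ℕ := fun j => (Finset.univ.filter fun i => colOf T i = j ∧ i.val < k).card with hd'
  have hdlen : ∀ j, d j ≤ lam.colLen j := fun j =>
    (Finset.card_le_card fun i hi => by
      simp only [Finset.mem_filter, Finset.mem_univ, true_and] at hi ⊢
      exact hi.1).trans (card_colOf_le_colLen (j := j) T)
  -- Within column `j`, `τ` matches the small entries with the entries in the top `d j` boxes; the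
  -- counts agree by definition of `d`.
  obtain ⟨τ, hτ⟩ := exists_perm_of_card_fibre_eq
    (f := fun i => (colOf T i, decide (i.val < k)))
    (g := fun i => (colOf T i, decide (rowOf T i < d (colOf T i)))) (by
      have htrue : ∀ j, (Finset.univ.filter fun i => colOf T i = j ∧ i.val < k).card =
          (Finset.univ.filter fun i => colOf T i = j ∧ rowOf T i < d (colOf T i)).card := by
        intro j
        change d j = _
        rw [← card_colOf_rowOf_lt T (hdlen j)]
        congr 1
        refine Finset.filter_congr fun i _ => and_congr_right fun hi => ?_
        rw [hi]
      rintro ⟨j, _ | _⟩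
      · have h1 := Finset.card_filter_add_card_filter_not
          (s := Finset.univ.filter fun i => colOf T i = j) (fun i => i.val < k)
        have h2 := Finset.card_filter_add_card_filter_not
          (s := Finset.univ.filter fun i => colOf T i = j) (fun i => rowOf T i < d (colOf T i))
        rw [Finset.filter_filter, Finset.filter_filter] at h1 h2
        have h3 := htrue j
        simp only [Prod.mk.injEq, decide_eq_false_iff_not]
        omega
      · simpa only [Prod.mk.injEq, decide_eq_true_eq] using htrue j)
  have hcol : ∀ i, colOf T (τ i) = colOf T i := fun i => congrArg Prod.fst (hτ i)
  have hrow : ∀ i, rowOf T (τ i) < d (colOf T i) ↔ i.val < k := by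
    intro i
    have := congrArg Prod.snd (hτ i)
    rw [← hcol i]
    simpa using this
  have hmem : ∀ c : ℕ × ℕ, (∃ i : Fin k, (T.symm (τ (Fin.castAdd m i))).1 = c) ↔
      c ∈ lam ∧ c.1 < d c.2 := by
    intro c
    constructor
    · rintro ⟨i, rfl⟩
      refine ⟨(T.symm _).2, ?_⟩
      have h1 := (hrow (Fin.castAdd m i)).mpr (by simp)
      rw [← hcol] at h1
      exact h1
    · rintro ⟨hc, hlt⟩
      have h1 : (τ⁻¹ (T ⟨c, hc⟩)).val < k := by
        rw [← hrow, ← hcol, perm_apply_inv]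
        simpa [rowOf, colOf] using hlt
      refine ⟨⟨_, h1⟩, ?_⟩
      have h2 : Fin.castAdd m ⟨_, h1⟩ = τ⁻¹ (T ⟨c, hc⟩) := rfl
      rw [h2, perm_apply_inv, Equiv.symm_apply_apply]
  let delta : YoungDiagram :=
    { cells := Finset.univ.image fun i : Fin k => (T.symm (τ (Fin.castAdd m i))).1
      isLowerSet := by
        intro a b hba ha
        simp only [Finset.coe_image, Finset.coe_univ, Set.image_univ, Set.mem_range] at ha ⊢
        rw [hmem] at ha ⊢
        exact ⟨lam.isLowerSet hba ha.1, hba.1.trans_lt (ha.2.trans_le (hd hba.2))⟩ }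
  have hdelta : ∀ c, c ∈ delta ↔ ∃ i : Fin k, (T.symm (τ (Fin.castAdd m i))).1 = c := by
    intro c
    rw [← YoungDiagram.mem_cells]
    simp [delta]
  have hle : delta ≤ lam := fun c hc => ((hmem c).mp ((hdelta c).mp hc)).1
  let e : Fin k ≃ {c : ℕ × ℕ // c ∈ delta} := Equiv.ofBijective
    (fun i => ⟨(T.symm (τ (Fin.castAdd m i))).1, (hdelta _).mpr ⟨i, rfl⟩⟩) (by
      constructor
      · intro i i' hi
        have h1 := τ.injective (T.symm.injective (Subtype.ext (Subtype.mk.inj hi)))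
        exact Fin.castAdd_injective k m h1
      · rintro ⟨c, hc⟩
        obtain ⟨i, hi⟩ := (hdelta c).mp hc
        exact ⟨i, Subtype.ext hi⟩)
  refine ⟨τ, hcol, delta, hle, e.symm, ?_⟩
  intro c
  obtain ⟨i, rfl⟩ := e.surjective c
  rw [Equiv.symm_apply_apply, Equiv.trans_apply]
  change τ⁻¹ (T (T.symm (τ (Fin.castAdd m i)))) = Fin.castAdd m i
  rw [Equiv.apply_symm_apply, perm_inv_apply]

end Subtableau

/-! ### Nonvanishing of the square of a Young symmetrizer -/

section QuasiIdempotent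

variable {μ : YoungDiagram} {A : Type*} [Fintype A] [DecidableEq A] {K : Type*} [Field K]

/-- A permutation preserving both rows and columns fixes every box, so only the product 1 · 1
contributes. -/
theorem coeff_one_youngSymmetrizer (T : YoungTableau μ A) :
    (youngSymmetrizer K T).coeff 1 = 1 := by
  classical
  rw [youngSymmetrizer, colAntisymmetrizer_eq, rowSymmetrizer, Finset.sum_mul,
    MonoidAlgebra.coeff_sum, Finset.sum_apply', Finset.sum_eq_single 1]
  · rw [← MonoidAlgebra.one_def, one_mul, antisymmetrizer, MonoidAlgebra.coeff_sum,
      Finset.sum_apply', Finset.sum_eq_single 1]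
    · simp [signIn_one]
    · intro τ _ hτ
      simp [hτ]
    · simp
  · intro σ hσ hne
    rw [antisymmetrizer, Finset.mul_sum, MonoidAlgebra.coeff_sum, Finset.sum_apply']
    refine Finset.sum_eq_zero fun τ hτ => ?_
    rw [MonoidAlgebra.single_mul_single, MonoidAlgebra.coeff_single, Finsupp.single_apply,
      if_neg]
    intro h
    simp only [Finset.mem_filter, Finset.mem_univ, true_and] at hσ hτ
    refine hne (Equiv.ext fun a => T.symm.injective (Subtype.ext (Prod.ext (hσ a) ?_)))
    have hσ' : σ ∈ colSubgroup T := by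
      rw [eq_inv_of_mul_eq_one_left h]
      exact Subgroup.inv_mem _ hτ
    exact hσ' a
  · simp

theorem trace_mulLeft {G : Type*} [Group G] [Fintype G] (x : MonoidAlgebra K G) :
    LinearMap.trace K _ (LinearMap.mulLeft K x) = Fintype.card G * x.coeff 1 := by
  classical
  let b : Module.Basis G K (MonoidAlgebra K G) := .ofRepr (MonoidAlgebra.coeffLinearEquiv K)
  have hb : ∀ g, b g = MonoidAlgebra.single g 1 := fun g => rfl
  have hr : ∀ y : MonoidAlgebra K G, b.repr y = y.coeff := fun y => rfl
  rw [LinearMap.trace_eq_matrix_trace K b, Matrix.trace]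
  have h : ∀ g, (LinearMap.toMatrix b b (LinearMap.mulLeft K x)).diag g = x.coeff 1 := by
    intro g
    rw [Matrix.diag_apply, LinearMap.toMatrix_apply, hb, hr, LinearMap.mulLeft_apply,
      MonoidAlgebra.coeff_mul_single_eq_coeff_mul 1 (fun a _ => mul_eq_right), mul_one]
  rw [Finset.sum_congr rfl fun g _ => h g, Finset.sum_const, Finset.card_univ, nsmul_eq_mul]

/-- Otherwise left multiplication by the symmetrizer would be nilpotent, hence of trace zero,
whereas its trace is the order of the symmetric group. -/
theorem youngSymmetrizer_mul_self_ne_zero [CharZero K] (T : YoungTableau μ A) :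
    youngSymmetrizer K T * youngSymmetrizer K T ≠ 0 := by
  intro h
  have h1 : IsNilpotent (LinearMap.mulLeft K (youngSymmetrizer K T)) := by
    refine ⟨2, ?_⟩
    rw [LinearMap.pow_mulLeft, pow_two, h, LinearMap.mulLeft_zero_eq_zero]
  have h2 := (LinearMap.isNilpotent_trace_of_isNilpotent h1).eq_zero
  rw [trace_mulLeft, coeff_one_youngSymmetrizer, mul_one, Nat.cast_eq_zero] at h2
  exact Fintype.card_ne_zero h2

theorem youngSymmetrizer_mul_colAntisymmetrizer [CharZero K] (T : YoungTableau μ A) :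
    ∃ c : K, c ≠ 0 ∧ youngSymmetrizer K T * antisymmetrizer K (colSubgroup T) =
      c • youngSymmetrizer K T :=
  exists_mul_antisymmetrizer_eq_smul fun _ hτ => youngSymmetrizer_mul_single_of_mem T hτ

/-- The right annihilator of a Young symmetrizer contains the column and Garnir relations. -/
theorem isGarnirIdeal_ker_mulLeft [CharZero K] (T : YoungTableau μ A) :
    IsGarnirIdeal (colOf T) (LinearMap.ker (LinearMap.mulLeft K (youngSymmetrizer K T))) where
  mul_single_mem x hx σ := by
    rw [LinearMap.mem_ker, LinearMap.mulLeft_apply] at hx ⊢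
    rw [← mul_assoc, hx, zero_mul]
  antisymm τ hτ := by
    rw [LinearMap.mem_ker, LinearMap.mulLeft_apply, mul_sub,
      youngSymmetrizer_mul_single_of_mem T hτ, mul_smul_comm, mul_one, sub_self]
  garnir j Z hZ hcard := by
    rw [LinearMap.mem_ker, LinearMap.mulLeft_apply,
      youngSymmetrizer_mul_antisymmetrizer_symOn T hZ hcard]

end QuasiIdempotent

/-! ### Labels extending a function on the small letters -/

section Labels

theorem mem_of_mem_symOn {A : Type*} {Z : Set A} {σ : Equiv.Perm A} (hσ : σ ∈ symOn Z) {a : A}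
    (ha : a ∈ Z) : σ a ∈ Z := by
  rw [mem_symOn] at hσ
  by_contra h
  rw [σ.injective (hσ _ h)] at h
  exact h ha

theorem symOn_fibre_le {A : Type*} (ℓ : A → ℕ) (a : ℕ) : symOn {i | ℓ i = a} ≤ fibreSubgroup ℓ := by
  intro σ hσ i
  by_cases h : i ∈ {i | ℓ i = a}
  · exact (mem_of_mem_symOn hσ h : ℓ (σ i) = a).trans (h : ℓ i = a).symm
  · rw [mem_symOn.mp hσ i h]

variable {k m : ℕ}

theorem symOn_map_castAdd_le (Z : Set (Fin k)) :
    symOn (Fin.castAdd m '' Z) ≤ (symOn Z).map (embedPerm k m) := by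
  intro ρ hρ
  rw [mem_symOn] at hρ
  obtain ⟨σ, rfl⟩ := exists_embedPerm_eq (ρ := ρ) fun i => hρ _ (by
    rintro ⟨i', _, h⟩
    have := congrArg Fin.val h
    simp only [Fin.val_castAdd, Fin.val_natAdd] at this
    omega)
  refine ⟨σ, mem_symOn.mpr fun i hi => ?_, rfl⟩
  have h := hρ (Fin.castAdd m i) (by
    rintro ⟨i', hi', h⟩
    rw [Fin.castAdd_injective k m h] at hi'
    exact hi hi')
  rw [embedPerm_castAdd] at h
  exact Fin.castAdd_injective k m h

/-- A number larger than all labels of the first `k` letters. -/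
def labelBound (f : Fin k → ℕ) : ℕ := Finset.univ.sup f + 1

/-- The extension of `f` by distinct large labels. -/
def labels (m : ℕ) (f : Fin k → ℕ) : Fin (k + m) → ℕ :=
  Fin.addCases f fun i => labelBound f + i.val

@[simp]
theorem labels_castAdd (f : Fin k → ℕ) (i : Fin k) : labels m f (Fin.castAdd m i) = f i := by
  simp [labels]

@[simp]
theorem labels_natAdd (f : Fin k → ℕ) (i : Fin m) :
    labels m f (Fin.natAdd k i) = labelBound f + i.val := by
  simp [labels]

theorem lt_labelBound (f : Fin k → ℕ) (i : Fin k) : f i < labelBound f :=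
  Nat.lt_succ_of_le (Finset.le_sup (Finset.mem_univ i))

theorem labels_lt_labelBound_iff (f : Fin k → ℕ) (i : Fin (k + m)) :
    labels m f i < labelBound f ↔ i.val < k := by
  refine Fin.addCases (fun i => ?_) (fun i => ?_) i
  · simp [lt_labelBound]
  · simp

theorem map_embedPerm_le_fibreSubgroup (f : Fin k → ℕ) :
    (fibreSubgroup f).map (embedPerm k m) ≤ fibreSubgroup (labels m f) := by
  rintro _ ⟨σ, hσ, rfl⟩ i
  refine Fin.addCases (fun i => ?_) (fun i => ?_) i
  · rw [embedPerm_castAdd, labels_castAdd, labels_castAdd, hσ i]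
  · rw [embedPerm_natAdd]

/-- The added labels are distinct and exceed all values of `f`, so the only new fibres are
singletons. -/
theorem symOn_labels_le (f : Fin k → ℕ) (a : ℕ) :
    symOn {i | labels m f i = a} ≤ (fibreSubgroup f).map (embedPerm k m) := by
  intro ρ hρ
  have hfib := symOn_fibre_le _ _ hρ
  obtain ⟨σ, rfl⟩ := exists_embedPerm_eq (ρ := ρ) fun i => by
    have h := hfib (Fin.natAdd k i)
    generalize ρ (Fin.natAdd k i) = x at h
    revert h
    refine Fin.addCases (fun i' => ?_) (fun i' => ?_) x
    · intro h
      have := lt_labelBound f i'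
      simp only [labels_castAdd, labels_natAdd] at h
      omega
    · intro h
      simp only [labels_natAdd] at h
      congr 1
      ext
      omega
  refine ⟨σ, fun i => ?_, rfl⟩
  simpa using hfib (Fin.castAdd m i)

end Labels

/-! ### Restriction to the small letters and the induction -/

section Restriction

variable {lam : YoungDiagram} {k m : ℕ} {K : Type*} [Field K] [CharZero K]

/-- The sum of the column indices of the entries at most `k`. -/
def firstColSum (T : YoungTableau lam (Fin (k + m))) : ℕ := ∑ i : Fin k, colOf T (Fin.castAdd m i)

theorem sum_labels_lt_eq (f : Fin k → ℕ) (c : Fin (k + m) → ℕ) :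
    ∑ i with labels m f i < labelBound f, c i = ∑ i : Fin k, c (Fin.castAdd m i) := by
  simp only [labels_lt_labelBound_iff]
  rw [Finset.sum_filter, Fin.sum_univ_add]
  simp

/-- Antisymmetrizing over the fibres of `f : Fin k → ℕ` allows to replace a Young symmetrizer by
symmetrizers of tableaux whose first `k` entries form a subtableau in columns bounded by `f`. -/
theorem youngSymmetrizer_mul_antisymmetrizer_mem_span (T : YoungTableau lam (Fin (k + m)))
    (f : Fin k → ℕ) :
    youngSymmetrizer K T * antisymmetrizer K ((fibreSubgroup f).map (embedPerm k m)) ∈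
      Ideal.span {x | ∃ (T' : YoungTableau lam (Fin (k + m))) (delta : YoungDiagram)
        (h : delta ≤ lam) (S : YoungTableau delta (Fin k)),
        IsSubtableau h (Nat.le_add_right k m) S T' ∧ (∀ i, colOf S i ≤ f i) ∧
        firstColSum T' ≤ firstColSum T ∧ x = youngSymmetrizer K T'} := by
  classical
  set J := Ideal.span {x | ∃ (T' : YoungTableau lam (Fin (k + m))) (delta : YoungDiagram)
        (h : delta ≤ lam) (S : YoungTableau delta (Fin k)),
        IsSubtableau h (Nat.le_add_right k m) S T' ∧ (∀ i, colOf S i ≤ f i) ∧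
        firstColSum T' ≤ firstColSum T ∧ x = youngSymmetrizer K T'} with hJ
  -- With `b` equal to `labelBound f`, the labels below `b` are those of the small letters, so
  -- straightening does not increase their column sum.
  have h1 := single_mul_antisymmetrizer_mem_semistandard (isGarnirIdeal_ker_mulLeft (K := K) T)
    (symOn_labels_le f) (labelBound f) 1
  rw [← MonoidAlgebra.one_def, one_mul] at h1
  suffices h2 : Submodule.span K {x | ∃ σ' : Equiv.Perm (Fin (k + m)),
      IsSemistandard (fun i => colOf T (σ' i)) (labels m f) ∧
        ∑ i with labels m f i < labelBound f, colOf T (σ' i) ≤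
          ∑ i with labels m f i < labelBound f, colOf T ((1 : Equiv.Perm (Fin (k + m))) i) ∧
        x = MonoidAlgebra.single σ' 1 *
          antisymmetrizer K ((fibreSubgroup f).map (embedPerm k m))} ⊔
      LinearMap.ker (LinearMap.mulLeft K (youngSymmetrizer K T)) ≤
      (J.restrictScalars K).comap (LinearMap.mulLeft K (youngSymmetrizer K T)) from h2 h1
  refine sup_le (Submodule.span_le.mpr ?_) ?_
  · rintro _ ⟨σ', hss, hsum, rfl⟩
    change youngSymmetrizer K T * _ ∈ J
    rw [← mul_assoc, mul_antisymmetrizer]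
    refine J.sum_mem fun ρ hρ => Submodule.smul_of_tower_mem J _ ?_
    rw [mul_assoc, MonoidAlgebra.single_mul_single, mul_one, youngSymmetrizer_mul_single]
    refine J.mul_mem_left _ ?_
    simp only [Finset.mem_filter, Finset.mem_univ, true_and] at hρ
    have hρ' := map_embedPerm_le_fibreSubgroup f hρ
    have hss' := hss.comp_perm hρ'
    set T₁ := T.trans (σ' * ρ)⁻¹ with hT₁
    have hcol : ∀ i, colOf T₁ i = colOf T (σ' (ρ i)) := fun i => by
      rw [hT₁, colOf_trans, inv_inv, mul_apply]
    simp only [← hcol] at hss'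
    have hanti := hss'.antitone (labelBound f)
    simp only [labels_lt_labelBound_iff] at hanti
    -- Sorting inside the columns changes the symmetrizer only by a sign and left multiplication by
    -- `τ`.
    obtain ⟨τ, hτ, delta, hle, S, hS⟩ := exists_isSubtableau_of_antitone T₁ hanti
    have hcol' : ∀ i, colOf (T₁.trans τ⁻¹) i = colOf T₁ i := fun i => by
      rw [colOf_trans, inv_inv, hτ i]
    have hmem : youngSymmetrizer K (T₁.trans τ⁻¹) ∈ J := by
      refine Ideal.subset_span ⟨_, delta, hle, S, hS, fun i => ?_, ?_, rfl⟩
      · rw [← hS.colOf_castAdd, hcol', ← labels_castAdd (m := m) f]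
        exact hss'.le _
      · have h2 : firstColSum (T₁.trans τ⁻¹) =
            ∑ i with labels m f i < labelBound f, colOf T (σ' i) := by
          rw [firstColSum, ← sum_labels_lt_eq f, Finset.sum_filter, Finset.sum_filter,
            ← Equiv.sum_comp ρ fun i => if labels m f i < labelBound f then colOf T (σ' i) else 0]
          refine Finset.sum_congr rfl fun i _ => ?_
          rw [hρ' i, hcol', hcol]
        rw [h2]
        refine hsum.trans_eq ?_
        rw [sum_labels_lt_eq]
        rfl
    have h2 := youngSymmetrizer_mul_single_of_mem (K := K) T₁ hτ
    rw [youngSymmetrizer_mul_single] at h2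
    have h3 := Submodule.smul_of_tower_mem J (signIn K τ)
      (J.mul_mem_left (MonoidAlgebra.single τ 1) hmem)
    rwa [h2, smul_smul, signIn_mul_self, one_smul] at h3
  · intro x hx
    rw [LinearMap.mem_ker] at hx
    rw [Submodule.mem_comap, hx]
    exact Submodule.zero_mem _

variable (K) in
/-- The left ideal generated by the Young symmetrizers of tableaux whose first `k` entries lie
further to the left than those of `T`. -/
noncomputable def lowerIdeal (T : YoungTableau lam (Fin (k + m))) :
    Ideal (MonoidAlgebra K (Equiv.Perm (Fin (k + m)))) :=
  Ideal.span {x | ∃ T' : YoungTableau lam (Fin (k + m)), firstColSum T' < firstColSum T ∧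
    x = youngSymmetrizer K T'}

/-- Permuting the small letters among themselves does not change their column sum. -/
theorem mul_embedAlg_mem_lowerIdeal {K : Type*} [Field K] {T : YoungTableau lam (Fin (k + m))}
    {x : MonoidAlgebra K (Equiv.Perm (Fin (k + m)))} (hx : x ∈ lowerIdeal K T)
    (y : MonoidAlgebra K (Equiv.Perm (Fin k))) : x * embedAlg K k m y ∈ lowerIdeal K T := by
  induction y using MonoidAlgebra.induction_linear with
  | zero => simp
  | add y z hy hz => rw [map_add, mul_add]; exact Ideal.add_mem _ hy hz
  | single σ c =>
    have h : MonoidAlgebra.single σ c = c • MonoidAlgebra.single σ (1 : K) := by simp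
    rw [h, map_smul, mul_smul_comm, embedAlg_single]
    refine Submodule.smul_of_tower_mem _ _ ?_
    induction hx using Submodule.span_induction with
    | mem x hx =>
      obtain ⟨T', hT', rfl⟩ := hx
      rw [youngSymmetrizer_mul_single]
      refine Ideal.mul_mem_left _ _ (Ideal.subset_span ⟨_, ?_, rfl⟩)
      refine lt_of_eq_of_lt ?_ hT'
      rw [firstColSum, firstColSum, ← Equiv.sum_comp σ fun i => colOf T' (Fin.castAdd m i)]
      refine Finset.sum_congr rfl fun i _ => ?_
      rw [colOf_trans, inv_inv, embedPerm_castAdd]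
    | zero => simp
    | add x y _ _ hx hy => rw [add_mul]; exact Ideal.add_mem _ hx hy
    | smul a x _ hx => rw [smul_mul_assoc]; exact Submodule.smul_mem _ a hx

variable {mu : YoungDiagram} {h : mu ≤ lam} {S : YoungTableau mu (Fin k)}
  {T : YoungTableau lam (Fin (k + m))}

theorem embedPerm_mem_colSubgroup (hST : IsSubtableau h (Nat.le_add_right k m) S T)
    {τ : Equiv.Perm (Fin k)} (hτ : τ ∈ colSubgroup S) : embedPerm k m τ ∈ colSubgroup T := by
  intro i
  refine Fin.addCases (fun i => ?_) (fun i => ?_) i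
  · rw [embedPerm_castAdd, hST.colOf_castAdd, hST.colOf_castAdd, hτ i]
  · rw [embedPerm_natAdd]

/-- The Garnir relations of the subtableau hold modulo tableaux further to the left. -/
theorem youngSymmetrizer_mul_embedAlg_garnir_mem
    (hST : IsSubtableau h (Nat.le_add_right k m) S T) {j : ℕ} {Z : Finset (Fin k)}
    (hZ : ∀ i ∈ Z, colOf S i = j ∨ colOf S i = j + 1)
    (hcard : (Finset.univ.filter fun i => colOf S i = j).card < Z.card) :
    youngSymmetrizer K T * embedAlg K k m (antisymmetrizer K (symOn (Z : Set (Fin k)))) ∈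
      lowerIdeal K T := by
  classical
  set X := Z.map (Fin.castAddEmb m) with hX
  -- Adding the large entries of column `j` raises both sides of the cardinality condition equally,
  -- so `X ∪ Y` gives a Garnir relation of `T`.
  set Y := Finset.univ.filter fun i : Fin (k + m) => colOf T i = j ∧ ¬ i.val < k with hY
  have hXY : _root_.Disjoint X Y := by
    rw [Finset.disjoint_left]
    intro i hi hi'
    obtain ⟨i, _, rfl⟩ := Finset.mem_map.mp hi
    exact (Finset.mem_filter.mp hi').2.2 i.isLt
  have hZ' : ∀ i ∈ X ∪ Y, colOf T i = j ∨ colOf T i = j + 1 := by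
    intro i hi
    rcases Finset.mem_union.mp hi with hi | hi
    · obtain ⟨i, hiZ, rfl⟩ := Finset.mem_map.mp hi
      rw [Fin.castAddEmb_apply, hST.colOf_castAdd]
      exact hZ i hiZ
    · simp only [hY, Finset.mem_filter, Finset.mem_univ, true_and] at hi
      exact Or.inl hi.1
  have hcard' : (Finset.univ.filter fun i => colOf T i = j).card < (X ∪ Y).card := by
    rw [Finset.card_union_of_disjoint hXY,
      ← Finset.card_filter_add_card_filter_not (s := Finset.univ.filter fun i => colOf T i = j)
        (fun i => i.val < k), Finset.filter_filter, Finset.filter_filter, hX, Finset.card_map]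
    refine Nat.add_lt_add_right (lt_of_le_of_lt ?_ hcard) _
    rw [← Finset.card_map (s := Finset.univ.filter fun i => colOf S i = j) (Fin.castAddEmb m)]
    refine Finset.card_le_card fun i => ?_
    refine Fin.addCases (fun i => ?_) (fun i => ?_) i
    · intro hi
      simp only [Finset.mem_filter, Finset.mem_univ, true_and, hST.colOf_castAdd] at hi
      exact Finset.mem_map.mpr ⟨i, by simpa using hi.1, rfl⟩
    · intro hi
      simp at hi
  have hG := isGarnirIdeal_ker_mulLeft (K := K) T
  have hstep := single_mul_antisymmetrizer_mem_of_exchange hG.mul_single_mem hG.antisymm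
    (single_mul_antisymmetrizer_symOn_mem (σ := 1) hG hZ' hcard')
    (symOn_map_castAdd_le (m := m) (Z : Set (Fin k)))
  rw [← MonoidAlgebra.one_def, one_mul, ← embedAlg_antisymmetrizer] at hstep
  refine (show _ ≤ ((lowerIdeal K T).restrictScalars K).comap
    (LinearMap.mulLeft K (youngSymmetrizer K T)) from
    sup_le (Submodule.span_le.mpr ?_) fun x hx => ?_) hstep
  · rintro _ ⟨σ, hσ, ⟨i₀, hi₀, hne⟩, rfl⟩
    change youngSymmetrizer K T * _ ∈ lowerIdeal K T
    rw [← mul_assoc, one_mul, youngSymmetrizer_mul_single]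
    refine mul_embedAlg_mem_lowerIdeal (Ideal.mul_mem_left _ _ (Ideal.subset_span
      ⟨_, ?_, rfl⟩)) _
    simp only [one_apply] at hne
    -- The total column sum is invariant. Large letters of `Y` can only move right, and one of them
    -- does, so the small letters lose.
    have htot : ∑ i, colOf T (σ i) = ∑ i, colOf T i := Equiv.sum_comp σ fun i => colOf T i
    rw [Fin.sum_univ_add, Fin.sum_univ_add] at htot
    have hfix := mem_symOn.mp hσ
    have hle : ∀ i : Fin m, colOf T (Fin.natAdd k i) ≤ colOf T (σ (Fin.natAdd k i)) := by
      intro i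
      by_cases hi : Fin.natAdd k i ∈ X ∪ Y
      · have h1 := hZ' _ (by simpa using mem_of_mem_symOn hσ (by simpa using hi))
        rcases Finset.mem_union.mp hi with hi | hi
        · obtain ⟨i', _, h⟩ := Finset.mem_map.mp hi
          have := congrArg Fin.val h
          simp only [Fin.castAddEmb_apply, Fin.val_castAdd, Fin.val_natAdd] at this
          omega
        · simp only [hY, Finset.mem_filter, Finset.mem_univ, true_and] at hi
          omega
      · rw [hfix _ (by simpa using hi)]
    have hlt : ∑ i : Fin m, colOf T (Fin.natAdd k i) <
        ∑ i : Fin m, colOf T (σ (Fin.natAdd k i)) := by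
      obtain ⟨i₁, rfl⟩ : ∃ i₁ : Fin m, i₀ = Fin.natAdd k i₁ := by
        revert hi₀ hne
        refine Fin.addCases (fun i => ?_) (fun i => ?_) i₀
        · intro hi hne
          refine absurd ?_ hne
          rw [hfix]
          intro hmem
          rcases Finset.mem_union.mp (Finset.mem_coe.mp hmem) with hmem | hmem
          · obtain ⟨i', hi', h⟩ := Finset.mem_map.mp hmem
            exact hi ⟨i', hi', h⟩
          · exact (Finset.mem_filter.mp hmem).2.2 i.isLt
        · intro _ _
          exact ⟨i, rfl⟩
      exact Finset.sum_lt_sum (fun i _ => hle i)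
        ⟨i₁, Finset.mem_univ _, lt_of_le_of_ne (hle i₁) (Ne.symm hne)⟩
    have hsum : firstColSum (T.trans σ⁻¹) = ∑ i : Fin k, colOf T (σ (Fin.castAdd m i)) := by
      simp only [firstColSum, colOf_trans, inv_inv]
    rw [hsum, firstColSum]
    omega
  · rw [LinearMap.mem_ker] at hx
    rw [Submodule.mem_comap, hx]
    exact Submodule.zero_mem _

/-- The relations satisfied by `youngSymmetrizer K S` and, modulo tableaux further to the left,
by `youngSymmetrizer K T`. -/
noncomputable def relationIdeal (S : YoungTableau mu (Fin k)) (T : YoungTableau lam (Fin (k + m))) :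
    Submodule K (MonoidAlgebra K (Equiv.Perm (Fin k))) :=
  LinearMap.ker (LinearMap.mulLeft K (youngSymmetrizer K S)) ⊓
    ((lowerIdeal K T).restrictScalars K).comap
      (LinearMap.mulLeft K (youngSymmetrizer K T) ∘ₗ (embedAlg K k m).toLinearMap)

theorem mem_relationIdeal {K : Type*} [Field K] {x : MonoidAlgebra K (Equiv.Perm (Fin k))} :
    x ∈ relationIdeal S T ↔ youngSymmetrizer K S * x = 0 ∧
      youngSymmetrizer K T * embedAlg K k m x ∈ lowerIdeal K T := Iff.rfl

theorem isGarnirIdeal_relationIdeal (hST : IsSubtableau h (Nat.le_add_right k m) S T) :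
    IsGarnirIdeal (colOf S) (relationIdeal (K := K) S T) where
  mul_single_mem x hx σ := by
    rw [mem_relationIdeal] at hx ⊢
    rw [map_mul, ← mul_assoc, ← mul_assoc, hx.1, zero_mul]
    exact ⟨rfl, mul_embedAlg_mem_lowerIdeal hx.2 _⟩
  antisymm τ hτ := by
    rw [mem_relationIdeal, map_sub, map_smul, map_one, embedAlg_single, mul_sub, mul_sub,
      mul_smul_comm, mul_smul_comm, mul_one, mul_one, youngSymmetrizer_mul_single_of_mem S hτ,
      youngSymmetrizer_mul_single_of_mem T (embedPerm_mem_colSubgroup hST hτ), signIn_embedPerm,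
      sub_self, sub_self]
    exact ⟨rfl, Ideal.zero_mem _⟩
  garnir j Z hZ hcard := mem_relationIdeal.mpr
    ⟨youngSymmetrizer_mul_antisymmetrizer_symOn S hZ hcard,
      youngSymmetrizer_mul_embedAlg_garnir_mem hST hZ hcard⟩

/-- Label each letter by its own column. A semistandard rearrangement moves no letter right, and the
column sum is fixed, so it preserves columns; only multiples of the antisymmetrizer survive. -/
theorem mul_antisymmetrizer_mem_span_sup {G : Submodule K (MonoidAlgebra K (Equiv.Perm (Fin k)))}
    (hG : IsGarnirIdeal (colOf S) G) (x : MonoidAlgebra K (Equiv.Perm (Fin k))) :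
    x * antisymmetrizer K (colSubgroup S) ∈
      Submodule.span K {antisymmetrizer K (colSubgroup S)} ⊔ G := by
  induction x using MonoidAlgebra.induction_linear with
  | zero => simp
  | add x y hx hy => rw [add_mul]; exact Submodule.add_mem _ hx hy
  | single σ c =>
    have h : MonoidAlgebra.single σ c = c • MonoidAlgebra.single σ (1 : K) := by simp
    rw [h, smul_mul_assoc]
    refine Submodule.smul_mem _ _ (SetLike.le_def.mp
      (sup_le (Submodule.span_le.mpr ?_) le_sup_right)
      (single_mul_antisymmetrizer_mem_semistandard hG (symOn_fibre_le (colOf S)) 0 σ))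
    rintro _ ⟨σ', hss, -, rfl⟩
    have hσ' : σ' ∈ colSubgroup S := by
      have hsum : ∑ i, colOf S (σ' i) = ∑ i, colOf S i := Equiv.sum_comp σ' fun i => colOf S i
      intro i
      exact (Finset.sum_eq_sum_iff_of_le fun i _ => hss.le i).mp hsum i (Finset.mem_univ i)
    refine Submodule.mem_sup_left ?_
    change MonoidAlgebra.single σ' 1 * antisymmetrizer K (colSubgroup S) ∈ _
    rw [single_mul_antisymmetrizer hσ']
    exact Submodule.smul_mem _ _ (Submodule.mem_span_singleton_self _)

theorem youngSymmetrizer_mul_embedAlg_antisymmetrizer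
    (hST : IsSubtableau h (Nat.le_add_right k m) S T) :
    ∃ c : K, c ≠ 0 ∧ youngSymmetrizer K T * embedAlg K k m (antisymmetrizer K (colSubgroup S)) =
      c • youngSymmetrizer K T := by
  rw [embedAlg_antisymmetrizer]
  refine exists_mul_antisymmetrizer_eq_smul ?_
  rintro _ ⟨τ, hτ, rfl⟩
  exact youngSymmetrizer_mul_single_of_mem T (embedPerm_mem_colSubgroup hST hτ)

/-- Quasi-idempotence of Young symmetrizers with respect to a subtableau, modulo tableaux further
to the left. -/
theorem exists_youngSymmetrizer_mul_embedAlg_sub_smul_mem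
    (hST : IsSubtableau h (Nat.le_add_right k m) S T) :
    ∃ c : K, c ≠ 0 ∧ youngSymmetrizer K T * embedAlg K k m (youngSymmetrizer K S) -
      c • youngSymmetrizer K T ∈ lowerIdeal K T := by
  obtain ⟨x, hx, γ, hγ, hxγ⟩ := Submodule.mem_sup.mp (mul_antisymmetrizer_mem_span_sup
    (isGarnirIdeal_relationIdeal (K := K) hST) (rowSymmetrizer K S))
  obtain ⟨c, rfl⟩ := Submodule.mem_span_singleton.mp hx
  change _ = youngSymmetrizer K S at hxγ
  rw [mem_relationIdeal] at hγ
  obtain ⟨c₁, _, h₁⟩ := youngSymmetrizer_mul_colAntisymmetrizer (K := K) S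
  obtain ⟨c₂, hc₂, h₂⟩ := youngSymmetrizer_mul_embedAlg_antisymmetrizer (K := K) hST
  -- If `c` vanished, the symmetrizer of `S` would itself be a relation, so its square would be
  -- zero.
  have hc : c ≠ 0 := by
    rintro rfl
    refine youngSymmetrizer_mul_self_ne_zero (K := K) S ?_
    rw [zero_smul, zero_add] at hxγ
    rw [← hxγ] at hγ ⊢
    exact hγ.1
  refine ⟨c * c₂, mul_ne_zero hc hc₂, ?_⟩
  rw [← hxγ, map_add, map_smul, mul_add, mul_smul_comm, h₂, smul_smul, add_sub_cancel_left]
  exact hγ.2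

theorem youngSymmetrizer_mem_of_dominates
    (I : Ideal (MonoidAlgebra K (Equiv.Perm (Fin (k + m)))))
    (T : YoungTableau lam (Fin (k + m))) {mu : YoungDiagram} {h : mu ≤ lam}
    {S : YoungTableau mu (Fin k)} (hST : IsSubtableau h (Nat.le_add_right k m) S T)
    (hI : ∀ (delta : YoungDiagram) (S' : YoungTableau delta (Fin k)), delta ≤ lam →
      Dominates S' S → embedAlg K k m (youngSymmetrizer K S') ∈ I) :
    youngSymmetrizer K T ∈ I := by
  induction hs : firstColSum T using Nat.strong_induction_on generalizing T mu with
  | _ s ih =>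
  subst hs
  obtain ⟨c, hc, hmem⟩ := exists_youngSymmetrizer_mul_embedAlg_sub_smul_mem (K := K) hST
  obtain ⟨c₁, _, h₁⟩ := youngSymmetrizer_mul_colAntisymmetrizer (K := K) S
  obtain ⟨c₂, hc₂, h₂⟩ := youngSymmetrizer_mul_embedAlg_antisymmetrizer (K := K) hST
  -- Right multiplication by A_S produces tableaux whose subtableaux dominate `S`; by transitivity
  -- of dominance the hypothesis on `I` passes to them, and induction applies.
  have hlower : ∀ x ∈ lowerIdeal K T,
      x * embedAlg K k m (antisymmetrizer K (colSubgroup S)) ∈ I := by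
    intro x hx
    induction hx using Submodule.span_induction with
    | mem x hx =>
      obtain ⟨T', hT', rfl⟩ := hx
      rw [embedAlg_antisymmetrizer]
      refine Ideal.span_le.mpr ?_ (youngSymmetrizer_mul_antisymmetrizer_mem_span T' (colOf S))
      rintro _ ⟨T'', delta, hle, S'', hS'', hdom, hsum, rfl⟩
      exact ih _ (hsum.trans_lt hT') T'' hS''
        (fun delta' S' hle' hS' => hI delta' S' hle' fun i => (hS' i).trans (hdom i)) rfl
    | zero => simp
    | add x y _ _ hx hy => rw [add_mul]; exact I.add_mem hx hy
    | smul a x _ hx => rw [smul_mul_assoc]; exact I.smul_mem a hx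
  have h3 := hlower _ hmem
  rw [sub_mul, mul_assoc, ← map_mul, h₁, map_smul, mul_smul_comm, smul_mul_assoc, h₂,
    smul_smul] at h3
  have h4 := Submodule.smul_of_tower_mem I c₁ (I.mul_mem_left (youngSymmetrizer K T)
    (hI mu S h fun i => le_rfl))
  have h5 := Submodule.smul_of_tower_mem I (c * c₂)⁻¹ ((I.sub_mem_iff_right h4).mp h3)
  rwa [smul_smul, inv_mul_cancel₀ (mul_ne_zero hc hc₂), one_smul] at h5

end Restriction

theorem YoungTableau.card_eq {delta : YoungDiagram} {k : ℕ} (S : YoungTableau delta (Fin k)) :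
    delta.card = k := by
  have h : Fintype.card {c // c ∈ delta.cells} = Fintype.card (Fin k) := Fintype.card_congr S
  rwa [Fintype.card_fin, Fintype.card_coe] at h

end GenericTensor

theorem theorem3 {K : Type*} [Field K] [CharZero K]
    {k n : ℕ} (hk : 0 < k) (hkn : k ≤ n)
    {lam mu : YoungDiagram} (hlam : lam.card = n) (hmu : mu.card = k) (hsub : mu ≤ lam)
    (T : GenericTensor.YoungTableau lam (Fin n)) (S : GenericTensor.YoungTableau mu (Fin k))
    (hST : GenericTensor.IsSubtableau hsub hkn S T) :
    GenericTensor.incl K n (GenericTensor.youngSymmetrizer K T) ∈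
      GenericTensor.idealGenerated
        {x : GenericTensor.GenericTensorAlgebra K |
          ∃ (delta : YoungDiagram) (S' : GenericTensor.YoungTableau delta (Fin k)),
            delta.card = k ∧ delta ≤ lam ∧ GenericTensor.Dominates S' S ∧
              x = GenericTensor.incl K k (GenericTensor.youngSymmetrizer K S')} := by
  obtain ⟨m, rfl⟩ := Nat.exists_eq_add_of_le hkn
  have hideal := GenericTensor.isHomogeneousInvariantRightIdeal_idealGenerated
    {x : GenericTensor.GenericTensorAlgebra K |
      ∃ (delta : YoungDiagram) (S' : GenericTensor.YoungTableau delta (Fin k)),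
        delta.card = k ∧ delta ≤ lam ∧ GenericTensor.Dominates S' S ∧
          x = GenericTensor.incl K k (GenericTensor.youngSymmetrizer K S')}
  refine GenericTensor.youngSymmetrizer_mem_of_dominates
    (GenericTensor.componentIdeal hideal (k + m)) T hST fun delta S' hle hdom => ?_
  exact GenericTensor.incl_mul_embedAlg_mem hideal (GenericTensor.subset_idealGenerated _
    ⟨delta, S', S'.card_eq, hle, hdom, rfl⟩)
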